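/- For a continuous self-map $f$ of a metrizable space $X$ and $x\in X$ let $\alpha_f(x)=\bigcap_{n\ge 0}\overline{\bigcup_{k\ge n}f^{-k}(x)}$. A set of the form $\alpha_f(x)$, with $f\colon X\to X$ continuous and $x\in X$, is called an $\alpha$-limit set in $X$, and $X$ is an $\mathcal{AF}$-space if its $\alpha$-limit sets are exactly its closed subsets. Let $S=\{(x,\sin\frac1x):0<x\le\frac2\pi\}\subseteq\mathbb R^2$, $a=(0,1)$, $b=(0,-1)$, $c=(-1,-1)$. The extended sine curve is $X=\overline S\cup\{(x,-1):-1\le x\le 0\}$, and $[a,c]\subseteq X$ is the union of the segments $[a,b]$ and $[b,c]$. A chain of sine curves is a metrizable space $Y$ that is the union of homeomorphic copies $\overline S_i$ ($i\in\mathbb N$) of $\overline S$ and a point $s_\infty$ lying in none of them, such that every neighbourhood of $s_\infty$ contains all but finitely many $\overline S_i$, that $\overline S_i\cap\overline S_j=\emptyset$ for $|i-j|\ge 2$, and that $\overline S_i\cap\overline S_{i+1}$ is a single point $b_i$, which corresponds to one of the points $a,b$ in the copy $\overline S_i$ and to the point $(\frac2\pi,1)$ in the copy $\overline S_{i+1}$.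 Theorem. There are two connected compact metrizable $\mathcal{AF}$-spaces whose topological sum is not an $\mathcal{AF}$-space. More precisely: the extended sine curve $X$ is a connected compact metrizable $\mathcal{AF}$-space; chains of sine curves exist; and for every chain of sine curves $Y$, the space $Y$ is a connected compact metrizable $\mathcal{AF}$-space, the set $[a,c]\cup\{s_\infty\}$ is closed in $X\oplus Y$ but is not an $\alpha$-limit set in $X\oplus Y$, and hence $X\oplus Y$ is not an $\mathcal{AF}$-space. -/

import Mathlib

open Set Filter Topology

/-- The `α`-limit set of `x` under `f`: the intersection over `n` of the closures of
`⋃_{k ≥ n} f^{-k}(x)`. -/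
def alphaLimitSet {X : Type*} [TopologicalSpace X] (f : X → X) (x : X) : Set X :=
  ⋂ n : ℕ, closure (⋃ k ≥ n, f^[k] ⁻¹' {x})

/-- `A` is an `α`-limit set in `X` if `A = α_f(x)` for some continuous `f : X → X` and some
`x : X`. -/
def IsAlphaLimitSet {X : Type*} [TopologicalSpace X] (A : Set X) : Prop :=
  ∃ f : X → X, Continuous f ∧ ∃ x : X, A = alphaLimitSet f x

/-- The `AF`-property: the `α`-limit sets in `X` are exactly the closed subsets of `X`. -/
def HasAFProperty (X : Type*) [TopologicalSpace X] : Prop :=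
  {A : Set X | IsAlphaLimitSet A} = {A : Set X | IsClosed A}

/-- The open sine curve `S = {(x, sin (1/x)) : 0 < x ≤ 2/π}`. -/
def sineCurve : Set (ℝ × ℝ) :=
  {p | 0 < p.1 ∧ p.1 ≤ 2 / Real.pi ∧ p.2 = Real.sin (1 / p.1)}

/-- The closed topologist's sine curve, the closure of `S` in the plane. -/
def closedSineCurve : Set (ℝ × ℝ) := closure sineCurve

/-- The point `a`, the top endpoint of the convergence continuum `[a,b]` of `S`. -/
def ptA : ℝ × ℝ := (0, 1)

/-- The point `b`, the bottom endpoint of the convergence continuum `[a,b]` of `S`. -/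
def ptB : ℝ × ℝ := (0, -1)

/-- The point `c`, the free endpoint of the arc adjoined at `b`. -/
def ptC : ℝ × ℝ := (-1, -1)

/-- The unique endpoint `(2/π, sin (π/2))` of the open sine curve `S`. -/
noncomputable def sineEndpoint : ℝ × ℝ := (2 / Real.pi, 1)

/-- The extended sine curve: the closed topologist's sine curve with the arc `[b,c]` adjoined. -/
def extendedSineCurve : Set (ℝ × ℝ) :=
  closedSineCurve ∪ {p | -1 ≤ p.1 ∧ p.1 ≤ 0 ∧ p.2 = -1}

/-- The arc `[a,c]`, as a subset of the extended sine curve: the convergence continuum `[a,b]`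
followed by the adjoined arc `[b,c]`. -/
def arcAC : Set extendedSineCurve :=
  {p | (p : ℝ × ℝ) ∈ segment ℝ ptA ptB ∪ segment ℝ ptB ptC}

/-- A presentation of the topological space `Y` as a chain of sine curves: `Y` is the union of a
sequence of closed topologist's sine curves (the embedded copies `range (curve i)` of
`closedSineCurve`) and one more point `limitPt` to which they converge; the curves are pairwise
disjoint, except that consecutive ones meet in exactly one point `joint i`, which is an endpoint of
the convergence continuum of the `i`-th curve and the endpoint of the `(i+1)`-st open sine curve. -/
structure ChainOfSineCurves (Y : Type*) [TopologicalSpace Y] where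
  /-- the parametrization of the `i`-th closed sine curve -/
  curve : ℕ → closedSineCurve → Y
  /-- the common point `b_i` of the `i`-th and the `(i+1)`-st curve -/
  joint : ℕ → Y
  /-- the limit point `s_∞` -/
  limitPt : Y
  isEmbedding_curve : ∀ i, IsEmbedding (curve i)
  iUnion_range_union : (⋃ i, range (curve i)) ∪ {limitPt} = univ
  limitPt_notMem : ∀ i, limitPt ∉ range (curve i)
  /-- every neighbourhood of the limit point contains all but finitely many of the curves -/
  converges : ∀ U ∈ 𝓝 limitPt, ∀ᶠ i in atTop, range (curve i) ⊆ U
  inter_succ : ∀ i, range (curve i) ∩ range (curve (i + 1)) = {joint i}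
  disjoint_of_lt : ∀ i j, i + 1 < j → Disjoint (range (curve i)) (range (curve j))
  joint_mem_left : ∀ i, joint i ∈
    curve i '' {p | (p : ℝ × ℝ) = ptA ∨ (p : ℝ × ℝ) = ptB}
  joint_mem_right : ∀ i, joint i ∈
    curve (i + 1) '' {p | (p : ℝ × ℝ) = sineEndpoint}

/-- The subset `[a,c] ∪ {s_∞}` of the topological sum of the extended sine curve and a chain of
sine curves. -/
def arcAndLimit {Y : Type*} [TopologicalSpace Y] (C : ChainOfSineCurves Y) :
    Set (extendedSineCurve ⊕ Y) :=
  Sum.inl '' arcAC ∪ {Sum.inr C.limitPt}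

/-! Both AF-properties come from one observation: if a path leads from a closed set `A` out of `A`,
then `A` is an α-limit set. Let δ be the rest of the path after its last point in `A`, and let f(y)
= δ(dist(y, A)); then `A` collapses to the fixed point δ(0), the complement maps to itself, and
α_f(δ(0)) = `A` (`isAlphaLimitSet_of_path`). Only closed sets that no path leaves remain. In the
extended sine curve these are ∅, [a,c] and the whole space. In a chain they are ∅, {s_∞}, the whole
space, and the unions of the convergence continuum of one curve with all later curves and s_∞.
Constant maps and the identity settle all but [a,c] and the last type. For those, retract onto one
closed sine curve and apply the extension of (1/t, sin t) ↦ (1/(5t), sin 5t): it keeps the open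
curve and the convergence continuum apart, fixes both ends of the continuum, and iterated preimages
of such an end are dense in the continuum (`isAlphaLimitSet_of_retraction`).

Now suppose that f on the sum has α_f(z) = [a,c] ∪ {s_∞}. This set is forward invariant, and by
connectedness f sends each summand into one summand. If f(X) ⊆ Y, then f is constant on X, which
forces X into the α-limit set (`not_mapsTo_inr`). So f(X) ⊆ X. As preimages of z approach c, where X
is just the arc, z lies on [a,c]; hence f(Y) ⊆ X, for otherwise s_∞ would not be a limit of
preimages.

The main tool is `eventually_iterate_inl_ne`: a curve that misses the α-limit set but maps into the
arc cannot cover an interval of the arc in which late preimages of z accumulate, since these would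
pull back to a compact set free of the α-limit set. It shows that S cannot map into the arc
(`not_forall_sineParam_mem_arcAC`). So S maps into S, and all preimages of z in X lie on the arc.
Since small sine curves of Y converge to a point, some curve of Y, and then every later one, meets
the preimage of the arc and is mapped into it. The tool makes f constant on these curves, hence near
s_∞, and a curve of Y would belong to the α-limit set (`not_mapsTo_inl`). -/

section General

/-! ### General facts on α-limit sets -/

variable {X : Type*} [TopologicalSpace X]

theorem mem_alphaLimitSet_iff {f : X → X} {x y : X} :
    y ∈ alphaLimitSet f x ↔ ∀ n : ℕ, ∀ U ∈ 𝓝 y, ∃ k ≥ n, ∃ w ∈ U, f^[k] w = x := by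
  simp only [alphaLimitSet, mem_iInter, mem_closure_iff_nhds]
  refine forall_congr' fun n => forall₂_congr fun U _ => ?_
  constructor
  · rintro ⟨w, hwU, hw⟩
    simp only [mem_iUnion, mem_preimage, mem_singleton_iff] at hw
    obtain ⟨k, hk, hw⟩ := hw
    exact ⟨k, hk, w, hwU, hw⟩
  · rintro ⟨k, hk, w, hwU, hw⟩
    refine ⟨w, hwU, ?_⟩
    simp only [mem_iUnion, mem_preimage, mem_singleton_iff]
    exact ⟨k, hk, hw⟩

theorem mem_alphaLimitSet_of_frequently {f : X → X} {x y : X}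
    (h : ∀ n : ℕ, ∃ k ≥ n, f^[k] y = x) : y ∈ alphaLimitSet f x := by
  rw [mem_alphaLimitSet_iff]
  intro n U hU
  obtain ⟨k, hk, hy⟩ := h n
  exact ⟨k, hk, y, mem_of_mem_nhds hU, hy⟩

theorem isClosed_alphaLimitSet (f : X → X) (x : X) : IsClosed (alphaLimitSet f x) :=
  isClosed_iInter fun _ => isClosed_closure

theorem map_mem_alphaLimitSet {f : X → X} (hf : Continuous f) {x y : X}
    (hy : y ∈ alphaLimitSet f x) : f y ∈ alphaLimitSet f x := by
  rw [mem_alphaLimitSet_iff] at hy ⊢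
  intro n U hU
  obtain ⟨k, hk, w, hw, hwx⟩ := hy (n + 1) _ (hf.continuousAt hU)
  obtain ⟨m, rfl⟩ : ∃ m, k = m + 1 := ⟨k - 1, by omega⟩
  exact ⟨m, by omega, f w, hw, by rwa [Function.iterate_succ_apply] at hwx⟩

theorem iterate_mem_alphaLimitSet {f : X → X} (hf : Continuous f) {x y : X}
    (hy : y ∈ alphaLimitSet f x) (k : ℕ) : f^[k] y ∈ alphaLimitSet f x := by
  induction k with
  | zero => exact hy
  | succ k ih =>
    rw [Function.iterate_succ_apply']
    exact map_mem_alphaLimitSet hf ih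

/-- A compact set that misses an `α`-limit set of `x` misses almost all preimages of `x`. -/
theorem IsCompact.eventually_iterate_ne {f : X → X} {x : X} {K : Set X} (hK : IsCompact K)
    (hd : ∀ y ∈ K, y ∉ alphaLimitSet f x) : ∃ n : ℕ, ∀ k ≥ n, ∀ y ∈ K, f^[k] y ≠ x := by
  by_contra! hcon
  have := hK.inter_iInter_nonempty (fun n : ℕ => closure (⋃ k ≥ n, f^[k] ⁻¹' {x}))
    (fun _ => isClosed_closure) (fun u => by
      obtain ⟨k, hk, y, hyK, hy⟩ := hcon (u.sup id)
      refine ⟨y, hyK, mem_iInter₂.2 fun i hi => subset_closure ?_⟩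
      simp only [mem_iUnion, mem_preimage, mem_singleton_iff]
      exact ⟨k, (Finset.le_sup (f := id) hi).trans hk, hy⟩)
  obtain ⟨y, hyK, hy⟩ := this
  exact hd y hyK hy

theorem isAlphaLimitSet_empty [Nontrivial X] : IsAlphaLimitSet (∅ : Set X) := by
  obtain ⟨p, q, hpq⟩ := exists_pair_ne X
  refine ⟨fun _ => p, continuous_const, q, ?_⟩
  symm
  rw [eq_empty_iff_forall_notMem]
  intro y hy
  rw [mem_alphaLimitSet_iff] at hy
  obtain ⟨k, hk, w, -, hw⟩ := hy 1 univ univ_mem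
  obtain ⟨m, rfl⟩ : ∃ m, k = m + 1 := ⟨k - 1, by omega⟩
  rw [Function.iterate_succ_apply'] at hw
  exact hpq hw

theorem isAlphaLimitSet_univ [Nonempty X] : IsAlphaLimitSet (univ : Set X) := by
  obtain ⟨p⟩ := ‹Nonempty X›
  refine ⟨fun _ => p, continuous_const, p, ?_⟩
  symm
  rw [eq_univ_iff_forall]
  intro y
  refine mem_alphaLimitSet_of_frequently fun n => ⟨n + 1, by omega, ?_⟩
  rw [Function.iterate_succ_apply']

theorem isAlphaLimitSet_singleton [T1Space X] (x : X) : IsAlphaLimitSet ({x} : Set X) := by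
  refine ⟨id, continuous_id, x, Subset.antisymm ?_ fun y hy => ?_⟩
  · rintro _ rfl
    exact mem_alphaLimitSet_of_frequently fun n => ⟨n, le_rfl, by simp⟩
  · by_contra hne
    rw [mem_alphaLimitSet_iff] at hy
    obtain ⟨k, -, w, hw, hwx⟩ := hy 0 {x}ᶜ (isOpen_compl_singleton.mem_nhds hne)
    rw [Function.iterate_id, id] at hwx
    exact hw hwx

theorem hasAFProperty_iff : HasAFProperty X ↔ ∀ A : Set X, IsClosed A → IsAlphaLimitSet A := by
  constructor
  · intro h A hA
    exact h.symm.subset hA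
  · intro h
    refine Subset.antisymm ?_ h
    rintro _ ⟨f, -, x, rfl⟩
    exact isClosed_alphaLimitSet f x

/-- A closed set with a point that is accessible by a path from its complement is an `α`-limit
set. -/
theorem isAlphaLimitSet_of_path [TopologicalSpace.MetrizableSpace X] {A : Set X}
    (hA : IsClosed A) {γ : ℝ → X} (hγ : Continuous γ) {s t : ℝ} (hs : γ s ∈ A) (ht : γ t ∉ A) :
    IsAlphaLimitSet A := by
  let _ := TopologicalSpace.metrizableSpaceMetric X
  let B : Set ℝ := Icc 0 1 ∩ {r | γ (s + r * (t - s)) ∈ A}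
  have hcont : Continuous fun r : ℝ => γ (s + r * (t - s)) := by fun_prop
  have hB : IsCompact B := isCompact_Icc.inter_right (hA.preimage hcont)
  -- `m` is the last time, on the scale where `s` is 0 and `t` is 1, at which the path is in `A`;
  -- what follows it is δ.
  obtain ⟨m, ⟨hm, hmA⟩, hmax⟩ := hB.exists_isGreatest ⟨0, by simp, by simpa using hs⟩
  have hm1 : m < 1 := by
    refine lt_of_le_of_ne hm.2 ?_
    rintro rfl
    exact ht (by simpa using hmA)
  let δ : ℝ → X := fun r => γ (s + (m + (1 - m) * min 1 r) * (t - s))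
  have hδ : Continuous δ := by fun_prop
  have hδ0 : δ 0 ∈ A := by simpa [δ] using hmA
  have hδA : ∀ r, 0 < r → δ r ∉ A := by
    intro r hr hmem
    have hr1 : 0 < min 1 r := lt_min one_pos hr
    have hr2 : min 1 r ≤ 1 := min_le_left _ _
    have := hmax (show m + (1 - m) * min 1 r ∈ B from ⟨⟨by nlinarith [hm.1], by nlinarith⟩, hmem⟩)
    nlinarith
  -- This map sends `A` to its fixed point `δ 0` and the complement of `A` into itself.
  let f : X → X := fun y => δ (Metric.infDist y A)
  have hne : A.Nonempty := ⟨_, hs⟩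
  have hfA : ∀ y ∈ A, f y = δ 0 := fun y hy => by
    simp only [f, Metric.infDist_zero_of_mem hy]
  have hfA' : ∀ y, f y ∈ A → y ∈ A := by
    intro y hy
    by_contra hyA
    exact hδA _ ((hA.notMem_iff_infDist_pos hne).1 hyA) hy
  refine ⟨f, hδ.comp (Metric.continuous_infDist_pt A), δ 0, Subset.antisymm ?_ ?_⟩
  · intro y hy
    refine mem_alphaLimitSet_of_frequently fun n => ⟨n + 1, by omega, ?_⟩
    have : ∀ n, f^[n + 1] y = δ 0 := by
      intro n
      induction n with
      | zero => exact hfA y hy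
      | succ n ih => rw [Function.iterate_succ_apply', ih, hfA _ hδ0]
    exact this n
  · intro y hy
    have key : ∀ k w, f^[k] w ∈ A → w ∈ A := by
      intro k
      induction k with
      | zero => exact fun w hw => hw
      | succ k ih =>
        intro w hw
        rw [Function.iterate_succ_apply] at hw
        exact hfA' w (ih _ hw)
    rw [← hA.closure_eq, mem_closure_iff_nhds]
    rw [mem_alphaLimitSet_iff] at hy
    intro U hU
    obtain ⟨k, -, w, hw, hwx⟩ := hy 0 U hU
    exact ⟨w, hw, key k w (hwx ▸ hδ0)⟩

/-- A set that contains every curve `ℝ → X` that it meets. -/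
def IsCurveSaturated (A : Set X) : Prop :=
  ∀ γ : ℝ → X, Continuous γ → ∀ s t, γ s ∈ A → γ t ∈ A

theorem isCurveSaturated_of_not_isAlphaLimitSet [TopologicalSpace.MetrizableSpace X] {A : Set X}
    (hA : IsClosed A) (h : ¬ IsAlphaLimitSet A) : IsCurveSaturated A := by
  intro γ hγ s t hs
  by_contra ht
  exact h (isAlphaLimitSet_of_path hA hγ hs ht)

end General

/-! ### The closed sine curve and its quintupling map -/

section ClosedSineCurve

theorem mem_closedSineCurve_iff {p : ℝ × ℝ} : p ∈ closedSineCurve ↔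
    0 ≤ p.1 ∧ p.1 ≤ 2 / Real.pi ∧ -1 ≤ p.2 ∧ p.2 ≤ 1 ∧ (0 < p.1 → p.2 = Real.sin (1 / p.1)) := by
  constructor
  · intro hp
    have hbox : IsClosed ({q : ℝ × ℝ | 0 ≤ q.1} ∩ {q | q.1 ≤ 2 / Real.pi} ∩ {q | -1 ≤ q.2} ∩
        {q | q.2 ≤ 1}) :=
      (((isClosed_le continuous_const continuous_fst).inter
        (isClosed_le continuous_fst continuous_const)).inter
        (isClosed_le continuous_const continuous_snd)).inter
        (isClosed_le continuous_snd continuous_const)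
    have hsub : closedSineCurve ⊆ _ := closure_minimal (by
      rintro q ⟨h1, h2, h3⟩
      exact ⟨⟨⟨h1.le, h2⟩, show -1 ≤ q.2 from h3 ▸ Real.neg_one_le_sin _⟩,
        show q.2 ≤ 1 from h3 ▸ Real.sin_le_one _⟩) hbox
    obtain ⟨⟨⟨h1, h2⟩, h3⟩, h4⟩ := hsub hp
    refine ⟨h1, h2, h3, h4, fun h0 => ?_⟩
    obtain ⟨q, hq, hlim⟩ := mem_closure_iff_seq_limit.1 hp
    have hl1 : Tendsto (fun n => (q n).1) atTop (𝓝 p.1) := (continuous_fst.tendsto p).comp hlim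
    have hl2 : Tendsto (fun n => (q n).2) atTop (𝓝 p.2) := (continuous_snd.tendsto p).comp hlim
    have hl3 : Tendsto (fun n => Real.sin (1 / (q n).1)) atTop (𝓝 (Real.sin (1 / p.1))) :=
      (Real.continuous_sin.tendsto _).comp (tendsto_const_nhds.div hl1 h0.ne')
    exact tendsto_nhds_unique hl2 (hl3.congr fun n => (hq n).2.2.symm)
  · rintro ⟨h1, h2, h3, h4, h5⟩
    rcases h1.eq_or_lt with h0 | h0
    -- The points of `S` at height `p.2` with parameter `θ n` converge to `p`. The shift `n + 1`
    -- gives `θ n ≥ π / 2`, so that they do lie on `S`.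
    · let θ : ℕ → ℝ := fun n => Real.arcsin p.2 + ((n + 1 : ℕ) : ℝ) * (2 * Real.pi)
      have hθ : Tendsto θ atTop atTop := tendsto_atTop_add_const_left _ _
        (((tendsto_natCast_atTop_atTop (R := ℝ)).comp (tendsto_add_atTop_nat 1)).atTop_mul_const
          Real.two_pi_pos)
      have hθ' : ∀ n, Real.pi / 2 ≤ θ n := by
        intro n
        have := Real.neg_pi_div_two_le_arcsin p.2
        have hn : (1 : ℝ) ≤ ((n + 1 : ℕ) : ℝ) := by exact_mod_cast Nat.le_add_left 1 n
        have := Real.pi_pos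
        simp only [θ]
        nlinarith
      refine mem_closure_of_tendsto (f := fun n => ((θ n)⁻¹, p.2)) (b := atTop) ?_ ?_
      · have hp : p = (0, p.2) := Prod.ext h0.symm rfl
        conv => arg 3; rw [hp]
        exact (tendsto_inv_atTop_zero.comp hθ).prodMk_nhds tendsto_const_nhds
      · refine Eventually.of_forall fun n => ?_
        have hpos : 0 < Real.pi / 2 := by positivity
        refine ⟨inv_pos.2 (hpos.trans_le (hθ' n)), ?_, ?_⟩
        · rw [← inv_div]
          exact inv_anti₀ hpos (hθ' n)
        · simp only [one_div, inv_inv, θ]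
          rw [Real.sin_add_nat_mul_two_pi, Real.sin_arcsin h3 h4]
    · exact subset_closure ⟨h0, h2, h5 h0⟩

theorem closedSineCurve.fst_nonneg (p : closedSineCurve) : 0 ≤ p.1.1 :=
  (mem_closedSineCurve_iff.1 p.2).1

theorem isCompact_closedSineCurve : IsCompact closedSineCurve := by
  refine IsCompact.of_isClosed_subset (isCompact_Icc (a := ((0, -1) : ℝ × ℝ))
    (b := (2 / Real.pi, 1))) isClosed_closure fun p hp => ?_
  obtain ⟨h1, h2, h3, h4, -⟩ := mem_closedSineCurve_iff.1 hp
  exact ⟨⟨h1, h3⟩, ⟨h2, h4⟩⟩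

instance : CompactSpace closedSineCurve :=
  isCompact_iff_compactSpace.1 isCompact_closedSineCurve

/-- A parametrization of the open sine curve by the real line. -/
noncomputable def sineParam (t : ℝ) : closedSineCurve :=
  ⟨(1 / max t (Real.pi / 2), Real.sin (max t (Real.pi / 2))), by
    have hpos : 0 < Real.pi / 2 := by positivity
    refine subset_closure ⟨one_div_pos.2 (hpos.trans_le (le_max_right _ _)), ?_, ?_⟩
    · rw [← one_div_div Real.pi 2]
      exact one_div_le_one_div_of_le hpos (le_max_right _ _)
    · simp⟩

theorem continuous_sineParam : Continuous sineParam := by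
  refine Continuous.subtype_mk ?_ _
  refine Continuous.prodMk ?_ (by fun_prop)
  refine continuous_const.div (by fun_prop) fun t => ?_
  have hpos : 0 < Real.pi / 2 := by positivity
  exact (hpos.trans_le (le_max_right _ _)).ne'

theorem sineParam_fst_pos (t : ℝ) : 0 < (sineParam t).1.1 := by
  have hpos : 0 < Real.pi / 2 := by positivity
  exact one_div_pos.2 (hpos.trans_le (le_max_right _ _))

theorem exists_sineParam_eq {p : closedSineCurve} (hp : 0 < p.1.1) : ∃ t, sineParam t = p := by
  obtain ⟨-, h2, -, -, h5⟩ := mem_closedSineCurve_iff.1 p.2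
  have : max (1 / p.1.1) (Real.pi / 2) = 1 / p.1.1 := by
    refine max_eq_left ?_
    rw [← one_div_div]
    exact one_div_le_one_div_of_le hp h2
  refine ⟨1 / p.1.1, Subtype.ext (Prod.ext ?_ ?_)⟩
  · simp only [sineParam, this, one_div_one_div]
  · simp only [sineParam, this, h5 hp]

/-- A parametrization of the convergence continuum of the sine curve by the real line. -/
noncomputable def verticalParam (t : ℝ) : closedSineCurve :=
  ⟨(0, Real.sin t), mem_closedSineCurve_iff.2
    ⟨le_rfl, by positivity, Real.neg_one_le_sin _, Real.sin_le_one _, fun h => (lt_irrefl _ h).elim⟩⟩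

theorem continuous_verticalParam : Continuous verticalParam :=
  Continuous.subtype_mk (by fun_prop) _

@[simp] theorem verticalParam_fst (t : ℝ) : (verticalParam t).1.1 = 0 := rfl

theorem exists_verticalParam_eq {p : closedSineCurve} (hp : p.1.1 = 0) :
    ∃ t, verticalParam t = p := by
  obtain ⟨-, -, h3, h4, -⟩ := mem_closedSineCurve_iff.1 p.2
  exact ⟨Real.arcsin p.1.2, Subtype.ext (Prod.ext hp.symm (Real.sin_arcsin h3 h4))⟩

theorem mem_closure_sine (p : closedSineCurve) (c : ℝ) (hc : 0 < c) :
    p.1.1 = 0 → p ∈ closure {q : closedSineCurve | 0 < q.1.1 ∧ q.1.1 < c} := by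
  intro hp
  have h1 : p.1 ∈ closure (sineCurve ∩ {q | q.1 < c}) := by
    have hopen : IsOpen {q : ℝ × ℝ | q.1 < c} := isOpen_lt continuous_fst continuous_const
    rw [inter_comm]
    exact hopen.inter_closure ⟨by simpa [hp] using hc, p.2⟩
  rw [closure_subtype]
  refine closure_mono ?_ h1
  rintro q ⟨hq, hqc⟩
  exact ⟨⟨q, subset_closure hq⟩, ⟨hq.1, hqc⟩, rfl⟩

theorem mem_closure_range_sineParam (p : closedSineCurve) : p ∈ closure (range sineParam) := by
  rcases (closedSineCurve.fst_nonneg p).eq_or_lt with h | h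
  · refine closure_mono ?_ (mem_closure_sine p 1 one_pos h.symm)
    rintro q ⟨hq, -⟩
    exact exists_sineParam_eq hq
  · exact subset_closure (exists_sineParam_eq h)

instance : ConnectedSpace closedSineCurve := by
  have h := (isConnected_range continuous_sineParam).closure
  rw [(eq_univ_iff_forall.2 mem_closure_range_sineParam : closure (range sineParam) = univ)] at h
  exact connectedSpace_iff_univ.2 h

/-- A map from a connected and locally connected space to the closed sine curve takes its values
either in the open sine curve or in the convergence continuum. -/
theorem closedSineCurve.pos_or_eq_zero {W : Type*} [TopologicalSpace W] [PreconnectedSpace W]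
    [LocallyConnectedSpace W] {g : W → closedSineCurve} (hg : Continuous g) :
    (∀ w, 0 < (g w).1.1) ∨ ∀ w, (g w).1.1 = 0 := by
  have hg1 : Continuous fun w => (g w).1.1 := by fun_prop
  have hg2 : Continuous fun w => (g w).1.2 := by fun_prop
  have hclopen : IsClopen {w | (g w).1.1 = 0} := by
    refine ⟨isClosed_eq hg1 continuous_const, isOpen_iff_mem_nhds.2 fun w₀ hw₀ => ?_⟩
    have hopen : {w | |(g w).1.2 - (g w₀).1.2| < 1 / 2} ∈ 𝓝 w₀ :=
      (isOpen_lt (by fun_prop) continuous_const).mem_nhds (by simp)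
    obtain ⟨U, hU, hUo, hUw, hUc⟩ :=
      (locallyConnectedSpace_iff_subsets_isOpen_isConnected.1 ‹_›) w₀ _ hopen
    filter_upwards [hUo.mem_nhds hUw] with w hw
    by_contra hne
    have hpos : 0 < (g w).1.1 := lt_of_le_of_ne (closedSineCurve.fst_nonneg _) (Ne.symm hne)
    have hw₀' : (g w₀).1.1 = 0 := hw₀
    -- By the intermediate value theorem the image of `U` contains all of `V`. The closure of `V`
    -- has points of heights 1 and -1, while on `U` the height varies by less than 1.
    let V : Set closedSineCurve := {q | 0 < q.1.1 ∧ q.1.1 < (g w).1.1}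
    have hV : V ⊆ {q | |q.1.2 - (g w₀).1.2| ≤ 1 / 2} := by
      rintro q ⟨hq0, hq1⟩
      obtain ⟨w', hw', hqw⟩ := hUc.isPreconnected.intermediate_value hUw hw hg1.continuousOn
        (show q.1.1 ∈ Icc _ _ from ⟨hw₀'.symm ▸ hq0.le, hq1.le⟩)
      replace hqw : (g w').1.1 = q.1.1 := hqw
      have hq2 := (mem_closedSineCurve_iff.1 q.2).2.2.2.2 hq0
      have hw2 := (mem_closedSineCurve_iff.1 (g w').2).2.2.2.2 (by rwa [hqw])
      have hlt : |(g w').1.2 - (g w₀).1.2| < 1 / 2 := hU hw'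
      rw [hw2, hqw, ← hq2] at hlt
      exact hlt.le
    have hcl := closure_minimal hV (isClosed_le (by fun_prop) continuous_const)
    have htop := hcl (mem_closure_sine (verticalParam (Real.pi / 2)) _ hpos rfl)
    have hbot := hcl (mem_closure_sine (verticalParam (-(Real.pi / 2))) _ hpos rfl)
    simp only [verticalParam, mem_ofPred_eq, Real.sin_neg, Real.sin_pi_div_two, abs_le] at htop hbot
    linarith [htop.2, hbot.1]
  rcases isClopen_iff.1 hclopen with h | h
  · left
    intro w
    refine lt_of_le_of_ne (closedSineCurve.fst_nonneg _) fun h0 => ?_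
    exact (h ▸ (show w ∈ {w | (g w).1.1 = 0} from h0.symm) : w ∈ (∅ : Set W))
  · exact Or.inr fun w => (h.symm ▸ mem_univ w : w ∈ {w | (g w).1.1 = 0})

/-- Since sin 5x is a polynomial in sin x, quintupling the parameter extends continuously over the
convergence continuum. -/
theorem sin_five_mul (x : ℝ) :
    Real.sin (5 * x) = 16 * Real.sin x ^ 5 - 20 * Real.sin x ^ 3 + 5 * Real.sin x := by
  rw [show 5 * x = 3 * x + 2 * x by ring, Real.sin_add, Real.sin_three_mul, Real.cos_three_mul,
    Real.sin_two_mul, Real.cos_two_mul]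
  have h : Real.cos x ^ 2 = 1 - Real.sin x ^ 2 := by rw [← Real.sin_sq_add_cos_sq x]; ring
  have h4 : Real.cos x ^ 4 = (1 - Real.sin x ^ 2) ^ 2 := by rw [← h]; ring
  linear_combination (6 * Real.sin x - 8 * Real.sin x ^ 3 - 6 * Real.sin x) * h +
    8 * Real.sin x * h4

/-- The self-map of the closed sine curve that extends `(1 / t, sin t) ↦ (1 / (5 t), sin (5 t))`. -/
noncomputable def quintupling (p : closedSineCurve) : closedSineCurve :=
  ⟨(p.1.1 / 5, 16 * p.1.2 ^ 5 - 20 * p.1.2 ^ 3 + 5 * p.1.2), by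
    obtain ⟨h1, h2, h3, h4, h5⟩ := mem_closedSineCurve_iff.1 p.2
    have hs : 16 * p.1.2 ^ 5 - 20 * p.1.2 ^ 3 + 5 * p.1.2 = Real.sin (5 * Real.arcsin p.1.2) := by
      rw [sin_five_mul, Real.sin_arcsin h3 h4]
    refine mem_closedSineCurve_iff.2 ⟨by positivity, by simp only; linarith, ?_, ?_, fun h0 => ?_⟩
    · exact hs ▸ Real.neg_one_le_sin _
    · exact hs ▸ Real.sin_le_one _
    · have h0' : 0 < p.1.1 := by simp only at h0; linarith
      simp only [h5 h0']
      rw [← sin_five_mul, one_div_div, mul_one_div]⟩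

theorem continuous_quintupling : Continuous quintupling :=
  Continuous.subtype_mk (by fun_prop) _

theorem quintupling_iterate_fst (n : ℕ) (p : closedSineCurve) :
    (quintupling^[n] p).1.1 = p.1.1 / 5 ^ n := by
  induction n with
  | zero => simp
  | succ n ih =>
    rw [Function.iterate_succ_apply', pow_succ, ← div_div, ← ih]
    rfl

theorem quintupling_iterate_verticalParam (n : ℕ) (t : ℝ) :
    quintupling^[n] (verticalParam t) = verticalParam (5 ^ n * t) := by
  induction n with
  | zero => simp
  | succ n ih =>
    rw [Function.iterate_succ_apply', ih, pow_succ', mul_assoc]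
    refine Subtype.ext (Prod.ext ?_ ?_)
    · simp [quintupling]
    · simp only [quintupling, verticalParam]
      rw [sin_five_mul]

/-- This is where the factor 5 matters: 5 ≡ 1 mod 4, so sin 5x = sin x when sin x = ±1. Tripling
would swap the two ends. -/
theorem quintupling_eq_self {e : closedSineCurve} (he : e.1 = ptA ∨ e.1 = ptB) :
    quintupling e = e := by
  rcases he with he | he <;> refine Subtype.ext ?_ <;> simp only [quintupling, he, ptA, ptB] <;>
    norm_num

/-- On the convergence continuum the n-th iterate is sin t ↦ sin(5ⁿt), and the solutions r of 5ⁿr ≡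
s mod 2π have spacing 2π/5ⁿ. -/
theorem exists_tendsto_quintupling_iterate_eq (e p : closedSineCurve) (he : e.1.1 = 0)
    (hp : p.1.1 = 0) :
    ∃ q : ℕ → closedSineCurve, Tendsto q atTop (𝓝 p) ∧ ∀ n, quintupling^[n] (q n) = e := by
  obtain ⟨s, rfl⟩ := exists_verticalParam_eq he
  obtain ⟨t, rfl⟩ := exists_verticalParam_eq hp
  let r : ℕ → ℝ := fun n => (s + ⌊5 ^ n * t / (2 * Real.pi)⌋ * (2 * Real.pi)) / 5 ^ n
  have hr : ∀ n, ‖r n - t‖ ≤ (|s| + 2 * Real.pi) * (1 / 5) ^ n := by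
    intro n
    have h5 : (0 : ℝ) < 5 ^ n := by positivity
    have hpi := Real.two_pi_pos
    have hrew : r n - t = (s - Int.fract (5 ^ n * t / (2 * Real.pi)) * (2 * Real.pi)) / 5 ^ n := by
      simp only [r, Int.fract]
      field_simp
      ring
    rw [hrew, norm_div, Real.norm_eq_abs, Real.norm_eq_abs, abs_of_pos h5, one_div, inv_pow,
      ← div_eq_mul_inv]
    refine div_le_div_of_nonneg_right ((abs_sub _ _).trans (add_le_add_right ?_ _)) h5.le
    rw [abs_of_nonneg (mul_nonneg (Int.fract_nonneg _) hpi.le)]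
    exact mul_le_of_le_one_left hpi.le (Int.fract_lt_one _).le
  have hlim : Tendsto r atTop (𝓝 t) := by
    rw [tendsto_iff_norm_sub_tendsto_zero]
    refine squeeze_zero (fun _ => norm_nonneg _) hr ?_
    have := (tendsto_pow_atTop_nhds_zero_of_lt_one (r := (1 / 5 : ℝ)) (by norm_num)
      (by norm_num)).const_mul (|s| + 2 * Real.pi)
    rwa [mul_zero] at this
  refine ⟨fun n => verticalParam (r n), (continuous_verticalParam.tendsto t).comp hlim,
    fun n => ?_⟩
  rw [quintupling_iterate_verticalParam]
  have h5 : (5 : ℝ) ^ n ≠ 0 := by positivity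
  refine Subtype.ext (Prod.ext rfl ?_)
  simp only [verticalParam, r]
  rw [mul_div_cancel₀ _ h5, Real.sin_add_int_mul_two_pi]

/-- In a space that retracts onto a closed sine curve such that all points outside the curve that go
to the convergence continuum go to one of its endpoints, the preimage of the convergence continuum
is an `α`-limit set. -/
theorem isAlphaLimitSet_of_retraction {Z : Type*} [TopologicalSpace Z] {ι : closedSineCurve → Z}
    {ρ : Z → closedSineCurve} (hι : Continuous ι) (hρ : Continuous ρ) (hρι : ∀ p, ρ (ι p) = p)
    {e : closedSineCurve} (he : e.1 = ptA ∨ e.1 = ptB)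
    (h : ∀ z, (ρ z).1.1 = 0 → z ∈ range ι ∨ ρ z = e) :
    IsAlphaLimitSet {z | (ρ z).1.1 = 0} := by
  have he0 : e.1.1 = 0 := by rcases he with he | he <;> simp [he, ptA, ptB]
  -- As `ρ ∘ ι` is the identity, the iterates of `f` are those of `quintupling`, read through `ρ`
  -- and `ι`.
  let f : Z → Z := fun z => ι (quintupling (ρ z))
  have hf : ∀ n z, f^[n + 1] z = ι (quintupling^[n + 1] (ρ z)) := by
    intro n z
    induction n with
    | zero => rfl
    | succ n ih =>
      rw [Function.iterate_succ_apply', ih, Function.iterate_succ_apply' _ (n + 1)]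
      simp only [f, hρι]
  refine ⟨f, hι.comp (continuous_quintupling.comp hρ), ι e, Subset.antisymm ?_ ?_⟩
  · intro z hz
    rcases h z hz with ⟨p, rfl⟩ | hze
    · rw [mem_ofPred_eq, hρι] at hz
      obtain ⟨q, hq, hqe⟩ := exists_tendsto_quintupling_iterate_eq e p he0 hz
      rw [mem_alphaLimitSet_iff]
      intro n U hU
      have hev := ((hι.tendsto p).comp hq).eventually hU
      obtain ⟨m, hm, hmU⟩ := (hev.and (eventually_ge_atTop (n + 1))).exists
      obtain ⟨k, rfl⟩ : ∃ k, m = k + 1 := ⟨m - 1, by omega⟩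
      exact ⟨k + 1, by omega, ι (q (k + 1)), hm, by rw [hf, hρι, hqe]⟩
    · refine mem_alphaLimitSet_of_frequently fun n => ⟨n + 1, by omega, ?_⟩
      rw [hf, hze, Function.iterate_fixed (quintupling_eq_self he)]
  -- Quintupling divides the first coordinate by 5, so a preimage of `ι e` must already have first
  -- coordinate 0 under `ρ`.
  · intro z hz
    have hcl : IsClosed {z | (ρ z).1.1 = 0} := isClosed_eq (by fun_prop) continuous_const
    rw [← hcl.closure_eq, mem_closure_iff_nhds]
    rw [mem_alphaLimitSet_iff] at hz
    intro U hU
    obtain ⟨k, hk, w, hw, hwe⟩ := hz 1 U hU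
    obtain ⟨n, rfl⟩ : ∃ n, k = n + 1 := ⟨k - 1, by omega⟩
    refine ⟨w, hw, ?_⟩
    rw [hf] at hwe
    have := congrArg (fun q => (ρ q).1.1) hwe
    simp only [hρι, quintupling_iterate_fst, he0] at this
    simpa using this

end ClosedSineCurve

/-! ### The extended sine curve -/

section ExtendedSineCurve

/-- The inclusion of the closed sine curve in the extended sine curve. -/
def sineInclusion (p : closedSineCurve) : extendedSineCurve := ⟨p.1, Or.inl p.2⟩

theorem continuous_sineInclusion : Continuous sineInclusion :=
  continuous_subtype_val.subtype_mk _

/-- The retraction of the extended sine curve onto the closed sine curve. -/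
noncomputable def sineRetraction (p : extendedSineCurve) : closedSineCurve :=
  ⟨(max p.1.1 0, p.1.2), by
    rcases p.2 with hp | ⟨-, h1, h2⟩
    · rw [max_eq_left (mem_closedSineCurve_iff.1 hp).1]
      exact hp
    · refine mem_closedSineCurve_iff.2 ⟨le_max_right _ _, ?_, h2.ge, ?_, fun h => ?_⟩
      · rw [max_eq_right h1]
        positivity
      · simp [h2]
      · rw [max_eq_right h1] at h
        exact (lt_irrefl _ h).elim⟩

theorem continuous_sineRetraction : Continuous sineRetraction :=
  Continuous.subtype_mk (by fun_prop) _

theorem sineRetraction_sineInclusion (p : closedSineCurve) :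
    sineRetraction (sineInclusion p) = p :=
  Subtype.ext (Prod.ext (max_eq_left (closedSineCurve.fst_nonneg p)) rfl)

theorem sineInclusion_sineRetraction {p : extendedSineCurve} (hp : 0 ≤ p.1.1) :
    sineInclusion (sineRetraction p) = p :=
  Subtype.ext (Prod.ext (max_eq_left hp) rfl)

theorem sineRetraction_fst_eq_zero_iff {p : extendedSineCurve} :
    (sineRetraction p).1.1 = 0 ↔ p.1.1 ≤ 0 := max_eq_right_iff

theorem sineRetraction_fst_pos_iff {p : extendedSineCurve} :
    0 < (sineRetraction p).1.1 ↔ 0 < p.1.1 := by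
  simp [sineRetraction]

theorem extendedSineCurve.snd_of_neg {p : extendedSineCurve} (hp : p.1.1 < 0) : p.1.2 = -1 := by
  rcases p.2 with h | h
  · exact absurd (mem_closedSineCurve_iff.1 h).1 (not_le.2 hp)
  · exact h.2.2

theorem extendedSineCurve.neg_one_le_fst (p : extendedSineCurve) : -1 ≤ p.1.1 := by
  rcases p.2 with h | h
  · linarith [(mem_closedSineCurve_iff.1 h).1]
  · exact h.1

theorem extendedSineCurve.snd_mem (p : extendedSineCurve) : p.1.2 ∈ Icc (-1 : ℝ) 1 := by
  obtain ⟨-, -, h1, h2, -⟩ := mem_closedSineCurve_iff.1 (sineRetraction p).2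
  exact ⟨h1, h2⟩

/-- A parametrization of the arc adjoined to the closed sine curve by the real line. -/
noncomputable def tailParam (t : ℝ) : extendedSineCurve :=
  ⟨(-Real.sin t ^ 2, -1), Or.inr
    ⟨by simpa using Real.sin_sq_le_one t, by simpa using sq_nonneg (Real.sin t), rfl⟩⟩

theorem continuous_tailParam : Continuous tailParam :=
  Continuous.subtype_mk (by fun_prop) _

theorem tailParam_zero : tailParam 0 = sineInclusion (verticalParam (-(Real.pi / 2))) :=
  Subtype.ext (Prod.ext (by simp [tailParam, sineInclusion])
    (by simp [tailParam, sineInclusion, verticalParam]))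

theorem exists_tailParam_eq {p : extendedSineCurve} (hp : p.1.1 < 0) : ∃ t, tailParam t = p := by
  have h1 := extendedSineCurve.neg_one_le_fst p
  refine ⟨Real.arcsin √(-p.1.1), Subtype.ext (Prod.ext ?_ (extendedSineCurve.snd_of_neg hp).symm)⟩
  simp only [tailParam]
  rw [Real.sin_arcsin (by linarith [Real.sqrt_nonneg (-p.1.1)])
    (Real.sqrt_le_one.2 (by linarith)), Real.sq_sqrt (by linarith), neg_neg]

theorem mem_arcAC_iff {p : extendedSineCurve} : p ∈ arcAC ↔ p.1.1 ≤ 0 := by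
  have hAB : segment ℝ ptA ptB = {q : ℝ × ℝ | q.1 = 0 ∧ q.2 ∈ Icc (-1 : ℝ) 1} := by
    ext q
    simp only [segment_eq_image, ptA, ptB, mem_image, mem_ofPred_eq]
    constructor
    · rintro ⟨θ, ⟨h0, h1⟩, rfl⟩
      simp only [Prod.smul_mk, smul_eq_mul, Prod.mk_add_mk, mem_Icc]
      exact ⟨by ring, by linarith, by linarith⟩
    · rintro ⟨h0, h1, h2⟩
      refine ⟨(1 - q.2) / 2, ⟨by linarith, by linarith⟩, Prod.ext ?_ ?_⟩
      · simp [h0]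
      · simp only [Prod.smul_mk, smul_eq_mul, Prod.mk_add_mk]
        ring
  have hBC : segment ℝ ptB ptC = {q : ℝ × ℝ | q.1 ∈ Icc (-1 : ℝ) 0 ∧ q.2 = -1} := by
    ext q
    simp only [segment_eq_image, ptC, ptB, mem_image, mem_ofPred_eq]
    constructor
    · rintro ⟨θ, ⟨h0, h1⟩, rfl⟩
      simp only [Prod.smul_mk, smul_eq_mul, Prod.mk_add_mk, mem_Icc]
      exact ⟨⟨by linarith, by linarith⟩, by ring⟩
    · rintro ⟨⟨h1, h2⟩, h0⟩
      refine ⟨-q.1, ⟨by linarith, by linarith⟩, Prod.ext ?_ ?_⟩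
      · simp
      · simp only [Prod.smul_mk, smul_eq_mul, Prod.mk_add_mk, h0]
        ring
  simp only [arcAC, hAB, hBC, mem_ofPred_eq, mem_union]
  constructor
  · rintro (h | h)
    · exact h.1.le
    · exact h.1.2
  · intro h
    rcases h.eq_or_lt with h | h
    · exact Or.inl ⟨h, extendedSineCurve.snd_mem p⟩
    · exact Or.inr ⟨⟨extendedSineCurve.neg_one_le_fst p, h.le⟩, extendedSineCurve.snd_of_neg h⟩

theorem sineRetraction_fst_eq_zero_iff_mem_arcAC {p : extendedSineCurve} :
    (sineRetraction p).1.1 = 0 ↔ p ∈ arcAC := by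
  rw [sineRetraction_fst_eq_zero_iff, mem_arcAC_iff]

theorem isClosed_arcAC : IsClosed arcAC := by
  have : arcAC = {p | p.1.1 ≤ 0} := Set.ext fun _ => mem_arcAC_iff
  rw [this]
  exact isClosed_le (by fun_prop) continuous_const

theorem extendedSineCurve.eq_param (p : extendedSineCurve) :
    (∃ q, sineInclusion q = p) ∨ ∃ t, tailParam t = p := by
  rcases lt_or_ge p.1.1 0 with h | h
  · exact Or.inr (exists_tailParam_eq h)
  · exact Or.inl ⟨_, sineInclusion_sineRetraction h⟩

theorem range_sineInclusion_union :
    range sineInclusion ∪ range tailParam = univ :=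
  eq_univ_of_forall extendedSineCurve.eq_param

instance : CompactSpace extendedSineCurve := by
  refine isCompact_univ_iff.1 ?_
  have htail : range tailParam = {p | p.1.1 ≤ 0 ∧ p.1.2 = -1} := by
    refine Subset.antisymm ?_ ?_
    · rintro _ ⟨t, rfl⟩
      exact ⟨by simpa [tailParam] using sq_nonneg (Real.sin t), rfl⟩
    · rintro p ⟨h1, h2⟩
      rcases h1.eq_or_lt with h | h
      · exact ⟨0, Subtype.ext (Prod.ext (by simp [tailParam, h]) h2.symm)⟩
      · exact exists_tailParam_eq h
  have htail' : range tailParam = tailParam '' Icc 0 (2 * Real.pi) := by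
    have hper : Function.Periodic tailParam (2 * Real.pi) := fun t =>
      Subtype.ext (by simp [tailParam])
    refine Subset.antisymm ?_ (image_subset_range _ _)
    rintro _ ⟨t, rfl⟩
    obtain ⟨s, hs, hst⟩ := hper.exists_mem_Ico₀ Real.two_pi_pos t
    exact ⟨s, Ico_subset_Icc_self hs, hst.symm⟩
  rw [← range_sineInclusion_union, htail']
  exact (isCompact_range continuous_sineInclusion).union
    (isCompact_Icc.image continuous_tailParam)

instance : ConnectedSpace extendedSineCurve := by
  rw [connectedSpace_iff_univ, ← range_sineInclusion_union]
  refine (isConnected_range continuous_sineInclusion).union ?_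
    (isConnected_range continuous_tailParam)
  exact ⟨tailParam 0, ⟨_, tailParam_zero.symm⟩, mem_range_self _⟩

instance : Nontrivial extendedSineCurve :=
  ⟨⟨tailParam 0, sineInclusion (sineParam 0), fun h => by
    have := congrArg (fun q => (sineRetraction q).1.1) h
    simp only [tailParam_zero, sineRetraction_sineInclusion, verticalParam_fst] at this
    exact (sineParam_fst_pos 0).ne this⟩⟩

/-- The retraction collapses the adjoined arc to b, which is fixed by `quintupling`. -/
theorem isAlphaLimitSet_arcAC : IsAlphaLimitSet arcAC := by
  have h := isAlphaLimitSet_of_retraction (e := verticalParam (-(Real.pi / 2)))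
    continuous_sineInclusion continuous_sineRetraction sineRetraction_sineInclusion
    (Or.inr (by simp [verticalParam, ptB])) (fun p hp => by
      rw [sineRetraction_fst_eq_zero_iff] at hp
      rcases hp.eq_or_lt with h | h
      · exact Or.inl ⟨_, sineInclusion_sineRetraction h.ge⟩
      · refine Or.inr (Subtype.ext (Prod.ext ?_ ?_))
        · simp [sineRetraction, hp]
        · simp [sineRetraction, verticalParam, extendedSineCurve.snd_of_neg h])
  rwa [show {p | (sineRetraction p).1.1 = 0} = arcAC from
    Set.ext fun _ => sineRetraction_fst_eq_zero_iff_mem_arcAC] at h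

/-- A nonempty closed set that no path leaves contains [a,c] as soon as it meets it, and contains
the closure of S as soon as it meets S; so it is [a,c] or everything. -/
theorem hasAFProperty_extendedSineCurve : HasAFProperty extendedSineCurve := by
  rw [hasAFProperty_iff]
  intro A hA
  by_contra hcon
  have hsat := isCurveSaturated_of_not_isAlphaLimitSet hA hcon
  have hne : A.Nonempty := by
    by_contra hemp
    rw [not_nonempty_iff_eq_empty] at hemp
    exact hcon (hemp ▸ isAlphaLimitSet_empty)
  have hvert : ∀ s t, sineInclusion (verticalParam s) ∈ A → sineInclusion (verticalParam t) ∈ A :=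
    hsat _ (continuous_sineInclusion.comp continuous_verticalParam)
  have htail := hsat _ continuous_tailParam
  have harc : ∀ t, sineInclusion (verticalParam t) ∈ A → arcAC ⊆ A := by
    intro t ht p hp
    rcases (mem_arcAC_iff.1 hp).eq_or_lt with h | h
    · obtain ⟨s, hs⟩ := exists_verticalParam_eq (sineRetraction_fst_eq_zero_iff.2 h.le)
      rw [← sineInclusion_sineRetraction h.ge, ← hs]
      exact hvert t s ht
    · obtain ⟨s, rfl⟩ := exists_tailParam_eq h
      exact htail 0 s (tailParam_zero ▸ hvert t _ ht)
  by_cases hsine : ∃ t, sineInclusion (sineParam t) ∈ A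
  · obtain ⟨t, ht⟩ := hsine
    have hall : ∀ s, sineInclusion (sineParam s) ∈ A := fun s =>
      hsat _ (continuous_sineInclusion.comp continuous_sineParam) t s ht
    have hincl : ∀ q, sineInclusion q ∈ A := fun q =>
      closure_minimal (range_subset_iff.2 hall : range sineParam ⊆ sineInclusion ⁻¹' A)
        (hA.preimage continuous_sineInclusion) (mem_closure_range_sineParam q)
    refine hcon ?_
    convert isAlphaLimitSet_univ (X := extendedSineCurve)
    refine eq_univ_of_forall fun p => ?_
    rcases extendedSineCurve.eq_param p with ⟨q, rfl⟩ | ⟨s, rfl⟩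
    · exact hincl q
    · exact htail 0 s (tailParam_zero ▸ hincl _)
  · have hsub : A ⊆ arcAC := by
      intro p hp
      rw [mem_arcAC_iff]
      by_contra! hpos
      obtain ⟨t, ht⟩ := exists_sineParam_eq (sineRetraction_fst_pos_iff.2 hpos)
      exact hsine ⟨t, by rwa [ht, sineInclusion_sineRetraction hpos.le]⟩
    refine hcon ?_
    convert isAlphaLimitSet_arcAC
    refine hsub.antisymm ?_
    obtain ⟨p, hp⟩ := hne
    rcases (mem_arcAC_iff.1 (hsub hp)).eq_or_lt with h | h
    · obtain ⟨s, hs⟩ := exists_verticalParam_eq (sineRetraction_fst_eq_zero_iff.2 h.le)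
      refine harc s ?_
      rwa [hs, sineInclusion_sineRetraction h.ge]
    · obtain ⟨s, rfl⟩ := exists_tailParam_eq h
      exact harc _ (tailParam_zero ▸ htail s 0 hp)

end ExtendedSineCurve

/-! ### Chains of sine curves -/

section ChainOfSineCurves

/-- The endpoint of the sine curve, as a point of the closed sine curve. -/
noncomputable def sineEnd : closedSineCurve := sineParam 0

theorem coe_sineEnd : (sineEnd : ℝ × ℝ) = sineEndpoint := by
  -- `sineParam` is constant for parameters up to π/2, so its value at 0 is the endpoint.
  have h : (0 : ℝ) ≤ Real.pi / 2 := by positivity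
  simp [sineEnd, sineParam, sineEndpoint, max_eq_right h]

theorem sineEnd_fst_pos : 0 < sineEnd.1.1 := sineParam_fst_pos 0

namespace ChainOfSineCurves

variable {Y : Type*} [TopologicalSpace Y] (C : ChainOfSineCurves Y)

theorem eq_limitPt_or_eq_curve (y : Y) : y = C.limitPt ∨ ∃ i p, C.curve i p = y := by
  have h := C.iUnion_range_union.symm ▸ mem_univ y
  rcases h with h | h
  · obtain ⟨i, hi⟩ := mem_iUnion.1 h
    exact Or.inr ⟨i, hi⟩
  · exact Or.inl h

theorem curve_ne_limitPt (i : ℕ) (p : closedSineCurve) : C.curve i p ≠ C.limitPt :=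
  fun h => C.limitPt_notMem i ⟨p, h⟩

theorem continuous_curve (i : ℕ) : Continuous (C.curve i) := (C.isEmbedding_curve i).continuous

theorem exists_curve_eq_joint (i : ℕ) :
    ∃ e : closedSineCurve, (e.1 = ptA ∨ e.1 = ptB) ∧ C.curve i e = C.joint i := C.joint_mem_left i

/-- The endpoint of the convergence continuum of the standard curve that corresponds to the joint of
the `i`-th and the `(i+1)`-st curve. -/
noncomputable def jointEnd (i : ℕ) : closedSineCurve := (C.exists_curve_eq_joint i).choose

theorem jointEnd_eq (i : ℕ) : (C.jointEnd i).1 = ptA ∨ (C.jointEnd i).1 = ptB :=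
  (C.exists_curve_eq_joint i).choose_spec.1

theorem curve_jointEnd (i : ℕ) : C.curve i (C.jointEnd i) = C.joint i :=
  (C.exists_curve_eq_joint i).choose_spec.2

theorem jointEnd_fst (i : ℕ) : (C.jointEnd i).1.1 = 0 := by
  rcases C.jointEnd_eq i with h | h <;> simp [h, ptA, ptB]

theorem curve_succ_sineEnd (i : ℕ) : C.curve (i + 1) sineEnd = C.joint i := by
  obtain ⟨p, hp, hpj⟩ := C.joint_mem_right i
  rw [show sineEnd = p from Subtype.ext (coe_sineEnd.trans hp.symm), hpj]

/-- An ultrafilter on this set that contains none of the curves contains no finite union of them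
either, so it converges to `limitPt`. -/
theorem isCompact_biUnion_union (I : Set ℕ) :
    IsCompact ((⋃ i ∈ I, range (C.curve i)) ∪ {C.limitPt}) := by
  rw [isCompact_iff_ultrafilter_le_nhds]
  intro F hF
  by_cases h : ∃ i ∈ I, range (C.curve i) ∈ F
  · obtain ⟨i, hi, hiF⟩ := h
    obtain ⟨y, hy, hyF⟩ := isCompact_iff_ultrafilter_le_nhds.1
      (isCompact_range (C.continuous_curve i)) F (le_principal_iff.2 hiF)
    exact ⟨y, Or.inl (mem_biUnion hi hy), hyF⟩
  · push Not at h
    refine ⟨C.limitPt, Or.inr rfl, fun U hU => ?_⟩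
    obtain ⟨N, hN⟩ := eventually_atTop.1 (C.converges U hU)
    have hfin : (⋃ i ∈ I ∩ Iio N, range (C.curve i)) ∉ F := by
      rw [Ultrafilter.finite_biUnion_mem_iff ((finite_Iio N).inter_of_right I)]
      rintro ⟨i, hi, hiF⟩
      exact h i hi.1 hiF
    have hcompl := Ultrafilter.compl_mem_iff_notMem.2 hfin
    filter_upwards [hcompl, le_principal_iff.1 hF] with y hy hyI
    rcases hyI with hyI | hyI
    · obtain ⟨i, hi, hyi⟩ := mem_iUnion₂.1 hyI
      by_cases hiN : i < N
      · exact (hy (mem_biUnion ⟨hi, hiN⟩ hyi)).elim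
      · exact hN i (not_lt.1 hiN) hyi
    · rw [mem_singleton_iff.1 hyI]
      exact mem_of_mem_nhds hU

theorem compactSpace {Y : Type*} [TopologicalSpace Y] (C : ChainOfSineCurves Y) : CompactSpace Y := by
  rw [← isCompact_univ_iff, ← C.iUnion_range_union]
  simpa using C.isCompact_biUnion_union univ

theorem limitPt_mem_closure {A : Set Y} {n : ℕ} (hA : ∀ i > n, (range (C.curve i) ∩ A).Nonempty) :
    C.limitPt ∈ closure A := by
  rw [mem_closure_iff_nhds]
  intro U hU
  obtain ⟨i, hi, hin⟩ := ((C.converges U hU).and (eventually_gt_atTop n)).exists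
  exact (hA i hin).mono (inter_subset_inter_left _ hi)

theorem isConnected_iUnion : IsConnected (⋃ i, range (C.curve i)) :=
  IsConnected.iUnion_of_chain (fun i => isConnected_range (C.continuous_curve i)) fun i => by
    rw [Order.succ_eq_add_one, C.inter_succ]
    exact singleton_nonempty _

theorem connectedSpace {Y : Type*} [TopologicalSpace Y] (C : ChainOfSineCurves Y) : ConnectedSpace Y := by
  have h := C.isConnected_iUnion.closure
  rwa [show closure (⋃ i, range (C.curve i)) = univ from ?_, ← connectedSpace_iff_univ] at h
  refine eq_univ_of_forall fun y => ?_
  rcases C.eq_limitPt_or_eq_curve y with rfl | ⟨i, p, rfl⟩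
  · refine C.limitPt_mem_closure (n := 0) fun i _ => ⟨C.curve i sineEnd, mem_range_self _, ?_⟩
    exact mem_iUnion.2 ⟨i, mem_range_self _⟩
  · exact subset_closure (mem_iUnion.2 ⟨i, mem_range_self _⟩)

theorem curve_ne_curve {i j : ℕ} (h : i + 1 < j) (p q : closedSineCurve) :
    C.curve i p ≠ C.curve j q := fun he =>
  disjoint_left.1 (C.disjoint_of_lt i j h) (mem_range_self p) (he ▸ mem_range_self q)

theorem eq_of_curve_eq_curve_of_lt {i j : ℕ} (h : i < j) {p q : closedSineCurve}
    (he : C.curve i p = C.curve j q) : p = C.jointEnd i ∧ q = sineEnd := by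
  obtain rfl : i + 1 = j := by
    by_contra hne
    exact C.curve_ne_curve (by omega) p q he
  have hmem : C.curve i p ∈ range (C.curve i) ∩ range (C.curve (i + 1)) :=
    ⟨mem_range_self _, he ▸ mem_range_self _⟩
  rw [C.inter_succ, mem_singleton_iff] at hmem
  constructor
  · exact (C.isEmbedding_curve i).injective (hmem.trans (C.curve_jointEnd i).symm)
  · exact (C.isEmbedding_curve (i + 1)).injective
      (he.symm.trans (hmem.trans (C.curve_succ_sineEnd i).symm))

open Classical in
/-- The retraction onto the `n`-th curve, read in the standard closed sine curve. -/
noncomputable def retraction (n : ℕ) (y : Y) : closedSineCurve :=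
  if h : ∃ p, C.curve n p = y then h.choose
  else if ∃ i < n, y ∈ range (C.curve i) then sineEnd else C.jointEnd n

theorem retraction_curve (n : ℕ) (p : closedSineCurve) : C.retraction n (C.curve n p) = p := by
  have h : ∃ q, C.curve n q = C.curve n p := ⟨p, rfl⟩
  rw [retraction, dif_pos h]
  exact (C.isEmbedding_curve n).injective h.choose_spec

theorem retraction_curve_of_lt {i n : ℕ} (hi : i < n) (p : closedSineCurve) :
    C.retraction n (C.curve i p) = sineEnd := by
  by_cases h : ∃ q, C.curve n q = C.curve i p
  · obtain ⟨q, hq⟩ := h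
    rw [← hq, retraction_curve]
    exact (C.eq_of_curve_eq_curve_of_lt hi hq.symm).2
  · rw [retraction, dif_neg h, if_pos ⟨i, hi, mem_range_self _⟩]

theorem retraction_curve_of_gt {i n : ℕ} (hi : n < i) (p : closedSineCurve) :
    C.retraction n (C.curve i p) = C.jointEnd n := by
  by_cases h : ∃ q, C.curve n q = C.curve i p
  · obtain ⟨q, hq⟩ := h
    rw [← hq, retraction_curve]
    exact (C.eq_of_curve_eq_curve_of_lt hi hq).1
  · rw [retraction, dif_neg h, if_neg]
    rintro ⟨j, hj, q, hq⟩
    exact C.curve_ne_curve (by omega) q p hq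

theorem retraction_limitPt (n : ℕ) : C.retraction n C.limitPt = C.jointEnd n := by
  rw [retraction, dif_neg fun ⟨p, hp⟩ => C.curve_ne_limitPt n p hp, if_neg]
  rintro ⟨j, -, q, hq⟩
  exact C.curve_ne_limitPt j q hq

/-- The chain is the union of three closed pieces: the curves before the `n`-th, the `n`-th curve,
and the later curves with `limitPt`. The retraction is constant on the first and the third. -/
theorem continuous_retraction [T2Space Y] (n : ℕ) : Continuous (C.retraction n) := by
  rw [continuous_iff_isClosed]
  intro F hF
  let L : Set Y := ⋃ i ∈ Iio n, range (C.curve i)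
  let R : Set Y := (⋃ i ∈ Ioi n, range (C.curve i)) ∪ {C.limitPt}
  have hL : IsClosed L := ((finite_Iio n).isCompact_biUnion fun i _ =>
    isCompact_range (C.continuous_curve i)).isClosed
  have hR : IsClosed R := (C.isCompact_biUnion_union _).isClosed
  have heq : C.retraction n ⁻¹' F =
      C.curve n '' F ∪ (L ∩ {_y | sineEnd ∈ F}) ∪ (R ∩ {_y | C.jointEnd n ∈ F}) := by
    refine Subset.antisymm (fun y hy => ?_) ?_
    · rw [mem_preimage] at hy
      rcases C.eq_limitPt_or_eq_curve y with rfl | ⟨i, p, rfl⟩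
      · rw [retraction_limitPt] at hy
        exact Or.inr ⟨Or.inr rfl, hy⟩
      · rcases lt_trichotomy i n with h | rfl | h
        · rw [C.retraction_curve_of_lt h] at hy
          exact Or.inl (Or.inr ⟨mem_biUnion h (mem_range_self p), hy⟩)
        · rw [retraction_curve] at hy
          exact Or.inl (Or.inl (mem_image_of_mem _ hy))
        · rw [C.retraction_curve_of_gt h] at hy
          exact Or.inr ⟨Or.inl (mem_biUnion h (mem_range_self p)), hy⟩
    · rintro y ((⟨p, hp, rfl⟩ | ⟨hy, hF'⟩) | ⟨hy, hF'⟩)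
      · rwa [mem_preimage, retraction_curve]
      · obtain ⟨i, hi, p, rfl⟩ := mem_iUnion₂.1 hy
        rwa [mem_preimage, C.retraction_curve_of_lt hi]
      · rcases hy with hy | hy
        · obtain ⟨i, hi, p, rfl⟩ := mem_iUnion₂.1 hy
          rwa [mem_preimage, C.retraction_curve_of_gt hi]
        · rw [mem_singleton_iff.1 hy, mem_preimage, retraction_limitPt]
          exact hF'
  rw [heq]
  exact (((hF.isCompact.image (C.continuous_curve n)).isClosed).union
    (hL.inter isClosed_const)).union (hR.inter isClosed_const)

theorem isAlphaLimitSet_retraction_preimage [T2Space Y] (n : ℕ) :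
    IsAlphaLimitSet {y | (C.retraction n y).1.1 = 0} := by
  refine isAlphaLimitSet_of_retraction (C.continuous_curve n) (C.continuous_retraction n)
    (C.retraction_curve n) (C.jointEnd_eq n) fun y hy => ?_
  rcases C.eq_limitPt_or_eq_curve y with rfl | ⟨i, p, rfl⟩
  · exact Or.inr (C.retraction_limitPt n)
  · rcases lt_trichotomy i n with h | rfl | h
    · rw [C.retraction_curve_of_lt h] at hy
      exact (sineEnd_fst_pos.ne' hy).elim
    · exact Or.inl (mem_range_self p)
    · exact Or.inr (C.retraction_curve_of_gt h p)

/-! ### Closed curve-saturated sets in a chain -/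

section Saturated

variable {C} {A : Set Y}

theorem curve_mem_of_sineParam_mem (hA : IsClosed A) (hsat : IsCurveSaturated A) {i : ℕ} {s : ℝ}
    (hs : C.curve i (sineParam s) ∈ A) (q : closedSineCurve) : C.curve i q ∈ A :=
  closure_minimal (range_subset_iff.2 fun t =>
      hsat _ ((C.continuous_curve i).comp continuous_sineParam) s t hs :
      range sineParam ⊆ C.curve i ⁻¹' A)
    (hA.preimage (C.continuous_curve i)) (mem_closure_range_sineParam q)

theorem curve_mem_of_fst_eq_zero (hsat : IsCurveSaturated A) {i : ℕ} {p q : closedSineCurve}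
    (hp : C.curve i p ∈ A) (hp0 : p.1.1 = 0) (hq0 : q.1.1 = 0) : C.curve i q ∈ A := by
  obtain ⟨s, rfl⟩ := exists_verticalParam_eq hp0
  obtain ⟨t, rfl⟩ := exists_verticalParam_eq hq0
  exact hsat _ ((C.continuous_curve i).comp continuous_verticalParam) s t hp

/-- Saturation spreads forward only: from any point of a curve one reaches its joint, which is the
endpoint of the next open sine curve, and closedness adds the next convergence continuum. -/
theorem curve_mem_of_lt (hA : IsClosed A) (hsat : IsCurveSaturated A) {i j : ℕ} (hij : i < j)
    {p : closedSineCurve} (hp : C.curve i p ∈ A) (q : closedSineCurve) : C.curve j q ∈ A := by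
  have hjoint : C.curve i (C.jointEnd i) ∈ A := by
    rcases (closedSineCurve.fst_nonneg p).eq_or_lt with h | h
    · exact curve_mem_of_fst_eq_zero hsat hp h.symm (C.jointEnd_fst i)
    · obtain ⟨s, rfl⟩ := exists_sineParam_eq h
      exact curve_mem_of_sineParam_mem hA hsat hp _
  have hstep : ∀ k, C.curve k (C.jointEnd k) ∈ A → ∀ q, C.curve (k + 1) q ∈ A := by
    intro k hk
    rw [C.curve_jointEnd, ← C.curve_succ_sineEnd] at hk
    exact curve_mem_of_sineParam_mem hA hsat hk
  induction j, hij using Nat.le_induction generalizing q with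
  | base => exact hstep i hjoint q
  | succ j _ ih => exact hstep j (ih _) q

theorem limitPt_mem_of_curve_mem (hA : IsClosed A) (hsat : IsCurveSaturated A) {i : ℕ}
    {p : closedSineCurve} (hp : C.curve i p ∈ A) : C.limitPt ∈ A := by
  rw [← hA.closure_eq]
  exact C.limitPt_mem_closure (n := i) fun j hj =>
    ⟨C.curve j sineEnd, mem_range_self _, curve_mem_of_lt hA hsat hj hp _⟩

end Saturated

theorem hasAFProperty {Y : Type*} [TopologicalSpace Y] (C : ChainOfSineCurves Y)
    [TopologicalSpace.MetrizableSpace Y] : HasAFProperty Y := by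
  rw [hasAFProperty_iff]
  intro A hA
  by_contra hcon
  have hsat := isCurveSaturated_of_not_isAlphaLimitSet hA hcon
  by_cases hex : ∃ i, ∃ p, C.curve i p ∈ A
  · classical
    let n := Nat.find hex
    obtain ⟨p, hp⟩ : ∃ p, C.curve n p ∈ A := Nat.find_spec hex
    have hmin : ∀ i < n, ∀ q, C.curve i q ∉ A := fun i hi q hq => Nat.find_min hex hi ⟨q, hq⟩
    have hlim := limitPt_mem_of_curve_mem hA hsat hp
    by_cases hsine : ∃ s, C.curve n (sineParam s) ∈ A
    · obtain ⟨s, hs⟩ := hsine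
      have hall := curve_mem_of_sineParam_mem hA hsat hs
      -- Otherwise the endpoint of the `n`-th curve would be a point of `A` on the preceding curve,
      -- against minimality of `n`.
      have hn : n = 0 := by
        by_contra hn
        obtain ⟨m, hm⟩ : ∃ m, n = m + 1 := ⟨n - 1, by omega⟩
        rw [hm] at hall
        refine hmin m (by omega) (C.jointEnd m) ?_
        rw [C.curve_jointEnd, ← C.curve_succ_sineEnd]
        exact hall _
      have : Nonempty Y := ⟨C.limitPt⟩
      refine hcon ?_
      convert isAlphaLimitSet_univ (X := Y)
      refine eq_univ_of_forall fun y => ?_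
      rcases C.eq_limitPt_or_eq_curve y with rfl | ⟨i, q, rfl⟩
      · exact hlim
      · rcases Nat.eq_zero_or_pos i with rfl | hi
        · exact hn ▸ hall q
        · exact curve_mem_of_lt hA hsat (hn.symm ▸ hi) hp q
    · have hcurve : ∀ q, C.curve n q ∈ A → q.1.1 = 0 := by
        intro q hq
        by_contra hne
        obtain ⟨s, rfl⟩ := exists_sineParam_eq
          (lt_of_le_of_ne (closedSineCurve.fst_nonneg q) (Ne.symm hne))
        exact hsine ⟨s, hq⟩
      refine hcon ?_
      -- Here `A` is the convergence continuum of the `n`-th curve together with all later curves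
      -- and `limitPt`.
      convert C.isAlphaLimitSet_retraction_preimage n
      ext y
      rw [mem_ofPred_eq]
      rcases C.eq_limitPt_or_eq_curve y with rfl | ⟨i, q, rfl⟩
      · rw [C.retraction_limitPt]
        exact iff_of_true hlim (C.jointEnd_fst n)
      · rcases lt_trichotomy i n with h | rfl | h
        · rw [C.retraction_curve_of_lt h]
          exact iff_of_false (hmin i h q) sineEnd_fst_pos.ne'
        · rw [C.retraction_curve]
          exact ⟨hcurve q, curve_mem_of_fst_eq_zero hsat hp (hcurve p hp)⟩
        · rw [C.retraction_curve_of_gt h]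
          exact iff_of_true (curve_mem_of_lt hA hsat h hp q) (C.jointEnd_fst n)
  · push Not at hex
    have hsub : A ⊆ {C.limitPt} := by
      intro y hy
      rcases C.eq_limitPt_or_eq_curve y with rfl | ⟨i, p, rfl⟩
      · rfl
      · exact (hex i p hy).elim
    rcases subset_singleton_iff_eq.1 hsub with rfl | rfl
    · have : Nontrivial Y := ⟨_, _, C.curve_ne_limitPt 0 sineEnd⟩
      exact hcon isAlphaLimitSet_empty
    · exact hcon (isAlphaLimitSet_singleton _)

end ChainOfSineCurves

/-! ### A planar model of a chain -/

/-- The map onto the `i`-th curve of the standard planar chain of sine curves. -/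
noncomputable def planarChainCurve (i : ℕ) (p : ℝ × ℝ) : ℝ × ℝ :=
  (1 / 2 : ℝ) ^ i • (p + (2 / Real.pi, -1))

/-- The standard planar chain of sine curves. -/
def planarChain : Set (ℝ × ℝ) :=
  (⋃ i, planarChainCurve i '' closedSineCurve) ∪ {0}

/-- The `i`-th curve lies over the interval 2⁻ⁱ[2/π, 4/π]. Consecutive intervals share one endpoint,
which is the right end for the later curve. -/
theorem eq_sineEndpoint_of_planarChainCurve_eq_succ {i : ℕ} {p q : closedSineCurve}
    (h : planarChainCurve i p.1 = planarChainCurve (i + 1) q.1) : q.1 = sineEndpoint := by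
  obtain ⟨-, h2, -, -, h5⟩ := mem_closedSineCurve_iff.1 q.2
  have h0 := closedSineCurve.fst_nonneg p
  have h1 := congrArg Prod.fst h
  simp only [planarChainCurve, Prod.smul_fst, Prod.fst_add, smul_eq_mul, pow_succ] at h1
  have hpos : (0 : ℝ) < (1 / 2) ^ i := by positivity
  have h3 : p.1.1 + 2 / Real.pi = 1 / 2 * (q.1.1 + 2 / Real.pi) := by
    rw [mul_assoc] at h1
    exact mul_left_cancel₀ hpos.ne' h1
  have hq : q.1.1 = 2 / Real.pi := by linarith
  refine Prod.ext hq ?_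
  rw [h5 (hq ▸ by positivity), hq, one_div_div, Real.sin_pi_div_two, sineEndpoint]

theorem planarChainCurve_ne {i j : ℕ} (h : i + 1 < j) (p q : closedSineCurve) :
    planarChainCurve i p.1 ≠ planarChainCurve j q.1 := by
  intro he
  obtain ⟨-, h2, -, -, -⟩ := mem_closedSineCurve_iff.1 q.2
  have h0 := closedSineCurve.fst_nonneg p
  have h0' := closedSineCurve.fst_nonneg q
  have h1 := congrArg Prod.fst he
  simp only [planarChainCurve, Prod.smul_fst, Prod.fst_add, smul_eq_mul] at h1
  have hpos : (0 : ℝ) < (1 / 2) ^ i := by positivity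
  have hpi : 0 < 2 / Real.pi := by positivity
  have hle : (1 / 2 : ℝ) ^ j ≤ (1 / 2) ^ i * (1 / 4) := by
    have := pow_le_pow_of_le_one (a := (1 / 2 : ℝ)) (by norm_num) (by norm_num)
      (show i + 2 ≤ j from h)
    rw [pow_add] at this
    norm_num at this ⊢
    exact this
  have h3 : (1 / 2 : ℝ) ^ j * (q.1.1 + 2 / Real.pi) ≤
      (1 / 2) ^ i * (1 / 4) * (2 / Real.pi + 2 / Real.pi) := by gcongr
  have h4 : (1 / 2 : ℝ) ^ i * (2 / Real.pi) ≤ (1 / 2) ^ i * (p.1.1 + 2 / Real.pi) := by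
    gcongr
    linarith
  nlinarith [mul_pos hpos hpi]

theorem planarChainCurve_ptA (i : ℕ) :
    planarChainCurve i ptA = planarChainCurve (i + 1) sineEndpoint := by
  simp only [planarChainCurve, ptA, sineEndpoint, pow_succ]
  refine Prod.ext ?_ ?_
  · simp only [Prod.mk_add_mk, Prod.smul_mk, smul_eq_mul]
    ring
  · simp

/-- The standard planar chain of sine curves is a chain of sine curves. -/
noncomputable def planarChainOfSineCurves : ChainOfSineCurves planarChain where
  curve i p := ⟨planarChainCurve i p.1, Or.inl (mem_iUnion.2 ⟨i, mem_image_of_mem _ p.2⟩)⟩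
  joint i := ⟨planarChainCurve (i + 1) sineEndpoint,
    Or.inl (mem_iUnion.2 ⟨i + 1, mem_image_of_mem _ (coe_sineEnd ▸ sineEnd.2)⟩)⟩
  limitPt := ⟨0, Or.inr rfl⟩
  isEmbedding_curve i := by
    refine (Continuous.isClosedEmbedding (Continuous.subtype_mk ?_ _) ?_).isEmbedding
    · unfold planarChainCurve
      fun_prop
    · intro p q hpq
      have h : planarChainCurve i p.1 = planarChainCurve i q.1 := congrArg Subtype.val hpq
      have h2 : (1 / 2 : ℝ) ^ i ≠ 0 := by positivity
      exact Subtype.ext (add_right_cancel (smul_right_injective _ h2 h))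
  iUnion_range_union := by
    refine eq_univ_of_forall ?_
    rintro ⟨y, hy | hy⟩
    · obtain ⟨i, p, hp, rfl⟩ := mem_iUnion.1 hy
      exact Or.inl (mem_iUnion.2 ⟨i, ⟨p, hp⟩, rfl⟩)
    · exact Or.inr (Subtype.ext hy)
  limitPt_notMem i := by
    rintro ⟨p, hp⟩
    have h : planarChainCurve i p.1 = 0 := congrArg Subtype.val hp
    have h1 := congrArg Prod.fst h
    simp only [planarChainCurve, Prod.smul_fst, Prod.fst_add, smul_eq_mul, Prod.fst_zero] at h1
    have h0 := closedSineCurve.fst_nonneg p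
    have : 0 < (1 / 2 : ℝ) ^ i * (p.1.1 + 2 / Real.pi) := by positivity
    exact this.ne' h1
  converges U hU := by
    obtain ⟨V, hV, hVU⟩ := mem_nhds_subtype _ _ _ |>.1 hU
    obtain ⟨ε, hε, hball⟩ := Metric.mem_nhds_iff.1 hV
    obtain ⟨M, hM⟩ := (isCompact_closedSineCurve.image
      (continuous_id.add continuous_const : Continuous fun p : ℝ × ℝ =>
        id p + (2 / Real.pi, -1))).isBounded.exists_norm_le
    have hlim := (tendsto_pow_atTop_nhds_zero_of_lt_one (r := (1 / 2 : ℝ)) (by norm_num)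
      (by norm_num)).mul_const M
    rw [zero_mul] at hlim
    filter_upwards [hlim.eventually_lt_const hε] with i hi
    rintro _ ⟨p, rfl⟩
    refine hVU (hball ?_)
    change planarChainCurve i p.1 ∈ Metric.ball 0 ε
    rw [mem_ball_zero_iff, planarChainCurve, norm_smul, norm_pow]
    refine lt_of_le_of_lt ?_ hi
    rw [Real.norm_of_nonneg (by norm_num : (0 : ℝ) ≤ 1 / 2)]
    gcongr
    exact hM _ ⟨p.1, p.2, rfl⟩
  inter_succ i := by
    refine Subset.antisymm ?_ ?_
    · rintro _ ⟨⟨p, rfl⟩, q, hq⟩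
      have h : planarChainCurve (i + 1) q.1 = planarChainCurve i p.1 := congrArg Subtype.val hq
      refine Subtype.ext ?_
      change planarChainCurve i p.1 = planarChainCurve (i + 1) sineEndpoint
      rw [← eq_sineEndpoint_of_planarChainCurve_eq_succ h.symm, h]
    · rintro _ rfl
      refine ⟨⟨verticalParam (Real.pi / 2), Subtype.ext ?_⟩, ⟨sineEnd, Subtype.ext ?_⟩⟩
      · simp only [← planarChainCurve_ptA, verticalParam, Real.sin_pi_div_two, ptA]
      · simp only [coe_sineEnd]
  disjoint_of_lt i j h := by
    rw [disjoint_left]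
    rintro _ ⟨p, rfl⟩ ⟨q, hq⟩
    exact planarChainCurve_ne h p q (congrArg Subtype.val hq).symm
  joint_mem_left i := by
    refine ⟨verticalParam (Real.pi / 2), Or.inl ?_, Subtype.ext ?_⟩
    · simp [verticalParam, ptA]
    · simp only [← planarChainCurve_ptA, verticalParam, Real.sin_pi_div_two, ptA]
  joint_mem_right i := ⟨sineEnd, coe_sineEnd, Subtype.ext (by simp only [coe_sineEnd])⟩

end ChainOfSineCurves

/-! ### The topological sum -/

section Sum

theorem exists_eq_inl_or_exists_eq_inr {W X Y : Type*} [TopologicalSpace W] [TopologicalSpace X]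
    [TopologicalSpace Y] [PreconnectedSpace W] {g : W → X ⊕ Y} (hg : Continuous g) :
    (∃ F : W → X, Continuous F ∧ ∀ w, g w = Sum.inl (F w)) ∨
      ∃ F : W → Y, Continuous F ∧ ∀ w, g w = Sum.inr (F w) := by
  rcases isClopen_iff.1 ((isClopen_range_inl (X := X) (Y := Y)).preimage hg) with h | h
  · right
    have hr : ∀ w, ∃ y, g w = Sum.inr y := by
      intro w
      rcases hw : g w with x | y
      · have : w ∈ g ⁻¹' range Sum.inl := ⟨x, hw.symm⟩
        rw [h] at this
        exact this.elim
      · exact ⟨y, rfl⟩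
    choose F hF using hr
    refine ⟨F, ?_, hF⟩
    exact IsEmbedding.inr.continuous_iff.2 (hg.congr hF)
  · left
    have hr : ∀ w, ∃ x, g w = Sum.inl x := by
      intro w
      have hw : w ∈ g ⁻¹' range Sum.inl := h.symm ▸ mem_univ w
      obtain ⟨x, hx⟩ := hw
      exact ⟨x, hx.symm⟩
    choose F hF using hr
    refine ⟨F, ?_, hF⟩
    exact IsEmbedding.inl.continuous_iff.2 (hg.congr hF)

theorem exists_iterate_inl_eq {X Y : Type*} [TopologicalSpace X] [TopologicalSpace Y]
    {f : X ⊕ Y → X ⊕ Y} {z : X ⊕ Y} {w : X} (hw : Sum.inl w ∈ alphaLimitSet f z) {V : Set X}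
    (hV : IsOpen V) (hwV : w ∈ V) (n : ℕ) : ∃ k ≥ n, ∃ p ∈ V, f^[k] (Sum.inl p) = z := by
  rw [mem_alphaLimitSet_iff] at hw
  obtain ⟨k, hk, _, ⟨p, hp, rfl⟩, h⟩ :=
    hw n _ ((isOpenMap_inl V hV).mem_nhds (mem_image_of_mem _ hwV))
  exact ⟨k, hk, p, hp, h⟩

/-- If an iterate of `f` is constant on the union of a neighbourhood of a point of an `α`-limit set
of `f` and a point `w`, then `w` belongs to this `α`-limit set. -/
theorem mem_alphaLimitSet_of_iterate_eq {X : Type*} [TopologicalSpace X] {f : X → X} {z y w : X}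
    (hy : y ∈ alphaLimitSet f z) {U : Set X} (hU : U ∈ 𝓝 y) (m : ℕ)
    (h : ∀ u ∈ U, f^[m] u = f^[m] w) : w ∈ alphaLimitSet f z := by
  refine mem_alphaLimitSet_of_frequently fun n => ?_
  rw [mem_alphaLimitSet_iff] at hy
  obtain ⟨k, hk, u, hu, huz⟩ := hy (n + m) U hU
  obtain ⟨l, rfl⟩ : ∃ l, k = l + m := ⟨k - m, by omega⟩
  refine ⟨l + m, by omega, ?_⟩
  rw [Function.iterate_add_apply, ← h u hu, ← Function.iterate_add_apply, huz]

/-- A coordinate on the arc `[a,c]`. -/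
def arcCoord (p : extendedSineCurve) : ℝ := p.1.1 + p.1.2

theorem continuous_arcCoord : Continuous arcCoord := by
  unfold arcCoord
  fun_prop

/-- The coordinate runs over [-1, 1] on [a,b] and over [-2, -1] on [b,c], with value -1 only at b.
-/
theorem injOn_arcCoord : InjOn arcCoord arcAC := by
  intro p hp q hq hpq
  rw [mem_arcAC_iff] at hp hq
  simp only [arcCoord] at hpq
  have hp2 := (extendedSineCurve.snd_mem p).1
  have hq2 := (extendedSineCurve.snd_mem q).1
  have hfst : p.1.1 = q.1.1 := by
    rcases hp.eq_or_lt with h | h <;> rcases hq.eq_or_lt with h' | h'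
    · rw [h, h']
    · have := extendedSineCurve.snd_of_neg h'
      linarith
    · have := extendedSineCurve.snd_of_neg h
      linarith
    · have := extendedSineCurve.snd_of_neg h
      have := extendedSineCurve.snd_of_neg h'
      linarith
  exact Subtype.ext (Prod.ext hfst (by linarith))

theorem isClosed_arcAndLimit {Y : Type*} [TopologicalSpace Y] [T1Space Y]
    (C : ChainOfSineCurves Y) : IsClosed (arcAndLimit C) := by
  refine (IsClosedEmbedding.inl.isClosedMap _ isClosed_arcAC).union ?_
  rw [← image_singleton]
  exact IsClosedEmbedding.inr.isClosedMap _ isClosed_singleton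

theorem inl_mem_arcAndLimit {Y : Type*} [TopologicalSpace Y] {C : ChainOfSineCurves Y}
    {p : extendedSineCurve} : Sum.inl p ∈ arcAndLimit C ↔ p ∈ arcAC := by
  simp [arcAndLimit]

theorem inr_mem_arcAndLimit {Y : Type*} [TopologicalSpace Y] {C : ChainOfSineCurves Y} {y : Y} :
    Sum.inr y ∈ arcAndLimit C ↔ y = C.limitPt := by
  simp [arcAndLimit]

theorem sineInclusion_sineParam_notMem (t : ℝ) : sineInclusion (sineParam t) ∉ arcAC := by
  rw [mem_arcAC_iff, not_le]
  exact sineParam_fst_pos t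

theorem sineInclusion_verticalParam_mem (t : ℝ) : sineInclusion (verticalParam t) ∈ arcAC :=
  mem_arcAC_iff.2 le_rfl

theorem exists_sineInclusion_verticalParam_eq {p : extendedSineCurve} (hp : p ∈ arcAC)
    (h : 0 ≤ p.1.1) : ∃ t, sineInclusion (verticalParam t) = p := by
  obtain ⟨t, ht⟩ := exists_verticalParam_eq (sineRetraction_fst_eq_zero_iff_mem_arcAC.2 hp)
  exact ⟨t, by rw [ht, sineInclusion_sineRetraction h]⟩

theorem exists_sineInclusion_sineParam_eq {p : extendedSineCurve} (hp : p ∉ arcAC) :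
    ∃ t, sineInclusion (sineParam t) = p := by
  rw [mem_arcAC_iff, not_le] at hp
  obtain ⟨t, ht⟩ := exists_sineParam_eq (sineRetraction_fst_pos_iff.2 hp)
  exact ⟨t, by rw [ht, sineInclusion_sineRetraction hp.le]⟩

theorem forall_notMem_arcAC_or_forall_mem {W : Type*} [TopologicalSpace W] [PreconnectedSpace W]
    [LocallyConnectedSpace W] {g : W → extendedSineCurve} (hg : Continuous g) :
    (∀ w, g w ∉ arcAC) ∨ ∀ w, g w ∈ arcAC := by
  simp only [← sineRetraction_fst_eq_zero_iff_mem_arcAC]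
  exact (closedSineCurve.pos_or_eq_zero (continuous_sineRetraction.comp hg)).imp_left
    fun h w => (h w).ne'

/-- If a curve misses the `α`-limit set of `z` and is mapped to the arc `[a,c]`, then the compact
parts of its image contain almost no preimages of `z`. -/
theorem eventually_iterate_inl_ne {Y : Type*} [TopologicalSpace Y]
    {f : extendedSineCurve ⊕ Y → extendedSineCurve ⊕ Y} {z : extendedSineCurve ⊕ Y}
    {γ : ℝ → extendedSineCurve ⊕ Y} (hγ : Continuous γ) {g : ℝ → extendedSineCurve}
    (hg : Continuous g) (hfg : ∀ t, f (γ t) = Sum.inl (g t)) (hgA : ∀ t, g t ∈ arcAC)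
    (hγα : ∀ t, γ t ∉ alphaLimitSet f z) (s t : ℝ) :
    ∃ n : ℕ, ∀ k ≥ n, ∀ y ∈ arcAC, arcCoord (g s) < arcCoord y → arcCoord y < arcCoord (g t) →
      f^[k] (Sum.inl y) ≠ z := by
  obtain ⟨n, hn⟩ := (isCompact_uIcc.image hγ : IsCompact (γ '' uIcc s t)).eventually_iterate_ne
    (f := f) (x := z) (by rintro _ ⟨r, -, rfl⟩; exact hγα r)
  refine ⟨n, fun k hk y hy hsy hyt hz => ?_⟩
  -- A point of the arc strictly between the two values has the form `g r`; if it reaches `z` in `k`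
  -- steps, then `γ r` does in `k + 1`.
  obtain ⟨r, hr, hry⟩ := intermediate_value_uIcc (continuous_arcCoord.comp hg).continuousOn
    (Icc_subset_uIcc ⟨hsy.le, hyt.le⟩)
  obtain rfl : g r = y := injOn_arcCoord (hgA r) hy hry
  refine hn (k + 1) (by omega) (γ r) (mem_image_of_mem _ hr) ?_
  rw [Function.iterate_succ_apply, hfg, hz]

/-! ### Excluding the possible behaviours of the map -/

section NotAlphaLimit

variable {Y : Type*} [TopologicalSpace Y] {C : ChainOfSineCurves Y}
  {f : extendedSineCurve ⊕ Y → extendedSineCurve ⊕ Y} {z : extendedSineCurve ⊕ Y}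

theorem not_mapsTo_inr [T2Space Y] (hα : arcAndLimit C = alphaLimitSet f z) (hf : Continuous f)
    {F : extendedSineCurve → Y} (hF : Continuous F) (hfF : ∀ p, f (Sum.inl p) = Sum.inr (F p)) :
    False := by
  have harc : ∀ p ∈ arcAC, F p = C.limitPt := by
    intro p hp
    rw [← inr_mem_arcAndLimit (C := C), ← hfF, hα]
    exact map_mem_alphaLimitSet hf (hα ▸ inl_mem_arcAndLimit.2 hp)
  have hG : Continuous fun q => F (sineInclusion q) := hF.comp continuous_sineInclusion
  have hsine : ∀ t, F (sineInclusion (sineParam t)) = C.limitPt := by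
    intro t₀
    rcases C.eq_limitPt_or_eq_curve (F (sineInclusion (sineParam t₀))) with h | ⟨i, p, hp⟩
    · exact h
    · exfalso
      -- The index `i + 1` rather than `i` is needed: this retraction sends the whole `i`-th curve
      -- to the endpoint, whose first coordinate is positive. Hence the image of S stays in the
      -- first curves, away from `limitPt`.
      have hpos : ∀ t, 0 < (C.retraction (i + 1) (F (sineInclusion (sineParam t)))).1.1 := by
        refine (closedSineCurve.pos_or_eq_zero ((C.continuous_retraction (i + 1)).comp
          (hG.comp continuous_sineParam))).resolve_right fun h => ?_
        have h0 : (C.retraction (i + 1) (F (sineInclusion (sineParam t₀)))).1.1 = 0 := h t₀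
        rw [← hp, C.retraction_curve_of_lt i.lt_succ_self] at h0
        exact sineEnd_fst_pos.ne' h0
      let L : Set Y := ⋃ j ∈ Iic (i + 1), range (C.curve j)
      have hL : IsClosed L := ((finite_Iic (i + 1)).isCompact_biUnion fun j _ =>
        isCompact_range (C.continuous_curve j)).isClosed
      have hsub : range sineParam ⊆ (fun q => F (sineInclusion q)) ⁻¹' L := by
        rintro _ ⟨t, rfl⟩
        have ht := hpos t
        rw [mem_preimage]
        rcases C.eq_limitPt_or_eq_curve (F (sineInclusion (sineParam t))) with h | ⟨j, q, hq⟩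
        · rw [h, C.retraction_limitPt, C.jointEnd_fst] at ht
          exact (lt_irrefl _ ht).elim
        · rw [← hq] at ht ⊢
          by_cases hj : j ≤ i + 1
          · exact mem_biUnion (mem_Iic.2 hj) (mem_range_self q)
          · rw [C.retraction_curve_of_gt (not_le.1 hj), C.jointEnd_fst] at ht
            exact (lt_irrefl _ ht).elim
      have hlim := closure_minimal hsub (hL.preimage hG)
        (mem_closure_range_sineParam (verticalParam 0))
      rw [mem_preimage, harc _ (sineInclusion_verticalParam_mem 0)] at hlim
      obtain ⟨j, -, hj⟩ := mem_iUnion₂.1 hlim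
      exact C.limitPt_notMem j hj
  have hall : ∀ p, F p = C.limitPt := by
    intro p
    by_cases hp : p ∈ arcAC
    · exact harc p hp
    · obtain ⟨t, rfl⟩ := exists_sineInclusion_sineParam_eq hp
      exact hsine t
  refine sineInclusion_sineParam_notMem 0 (inl_mem_arcAndLimit.1 (hα.symm ▸
    mem_alphaLimitSet_of_iterate_eq (hα ▸ inl_mem_arcAndLimit.2
      (sineInclusion_verticalParam_mem 0)) (isOpen_range_inl.mem_nhds (mem_range_self _)) 1 ?_))
  rintro _ ⟨p, rfl⟩
  simp only [Function.iterate_one, hfF, hall]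

theorem not_forall_sineParam_mem_arcAC (hα : arcAndLimit C = alphaLimitSet f z)
    {F : extendedSineCurve → extendedSineCurve} (hF : Continuous F)
    (hfF : ∀ p, f (Sum.inl p) = Sum.inl (F p)) (hFA : ∀ p ∈ arcAC, F p ∈ arcAC) :
    ¬ ∀ t, F (sineInclusion (sineParam t)) ∈ arcAC := by
  intro hS
  have hall : ∀ p, F p ∈ arcAC := by
    intro p
    by_cases hp : p ∈ arcAC
    · exact hFA p hp
    · obtain ⟨t, rfl⟩ := exists_sineInclusion_sineParam_eq hp
      exact hS t
  have hmem : ∀ p ∈ arcAC, Sum.inl p ∈ alphaLimitSet f z := fun p hp =>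
    hα ▸ inl_mem_arcAndLimit.2 hp
  have hG : Continuous fun q => F (sineInclusion q) := hF.comp continuous_sineInclusion
  let φ : closedSineCurve → ℝ := fun q => arcCoord (F (sineInclusion q))
  have hφ : Continuous φ := continuous_arcCoord.comp hG
  have hne := eventually_iterate_inl_ne (f := f) (z := z)
    (γ := fun t => Sum.inl (sineInclusion (sineParam t)))
    (continuous_inl.comp (continuous_sineInclusion.comp continuous_sineParam))
    (hG.comp continuous_sineParam) (fun t => hfF _) hS
    (fun t ht => sineInclusion_sineParam_notMem t (inl_mem_arcAndLimit.1 (hα.symm ▸ ht)))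
  -- Preimages of `z` near `w` may lie on S, but `F` moves them into the arc, where the bound `hne`
  -- applies one step later.
  have himage : ∀ w ∈ arcAC, ∀ s t, φ (sineParam s) < arcCoord (F w) →
      ¬ arcCoord (F w) < φ (sineParam t) := by
    intro w hw s t hs ht
    obtain ⟨n, hn⟩ := hne s t
    have hV : IsOpen {p | φ (sineParam s) < arcCoord (F p) ∧ arcCoord (F p) < φ (sineParam t)} :=
      (isOpen_lt continuous_const (continuous_arcCoord.comp hF)).inter
        (isOpen_lt (continuous_arcCoord.comp hF) continuous_const)
    obtain ⟨k, hk, p, ⟨hp1, hp2⟩, hpz⟩ := exists_iterate_inl_eq (hmem w hw) hV ⟨hs, ht⟩ (n + 1)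
    obtain ⟨m, rfl⟩ : ∃ m, k = m + 1 := ⟨k - 1, by omega⟩
    rw [Function.iterate_succ_apply, hfF] at hpz
    exact hn m (by omega) (F p) (hall p) hp1 hp2 hpz
  -- If `F` is not constant on S, then it maps S into [a,b]: otherwise the image would cover an
  -- interval of [b,c] off b, where all nearby points of the space lie on the arc.
  have htail : ∀ s t, φ (sineParam s) < φ (sineParam t) → -1 ≤ φ (sineParam s) := by
    intro s t hst
    by_contra! hlt
    obtain ⟨n, hn⟩ := hne s t
    obtain ⟨μ, hμ1, hμ2⟩ := exists_between (lt_min hst hlt)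
    rw [lt_min_iff] at hμ2
    have hlow : -2 ≤ φ (sineParam s) := by
      have h1 := extendedSineCurve.neg_one_le_fst (F (sineInclusion (sineParam s)))
      have h2 := (extendedSineCurve.snd_mem (F (sineInclusion (sineParam s)))).1
      simp only [φ, arcCoord]
      linarith
    let w : extendedSineCurve := ⟨(μ + 1, -1), Or.inr ⟨by simp only; linarith,
      by simp only; linarith, rfl⟩⟩
    have hwμ : arcCoord w = μ := by simp [w, arcCoord]
    have hV : IsOpen {p : extendedSineCurve | p.1.1 < 0 ∧ φ (sineParam s) < arcCoord p ∧
        arcCoord p < φ (sineParam t)} :=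
      (isOpen_lt (f := fun p : extendedSineCurve => p.1.1) (by fun_prop) continuous_const).inter
        ((isOpen_lt continuous_const continuous_arcCoord).inter
        (isOpen_lt continuous_arcCoord continuous_const))
    have hw0 : w.1.1 < 0 := by simp only [w]; linarith
    obtain ⟨k, hk, p, ⟨hp0, hp1, hp2⟩, hpz⟩ := exists_iterate_inl_eq
      (hmem w (mem_arcAC_iff.2 hw0.le)) hV ⟨hw0, hwμ.symm ▸ hμ1, hwμ.symm ▸ hμ2.1⟩ n
    exact hn k hk p (mem_arcAC_iff.2 hp0.le) hp1 hp2 hpz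
  -- By density of S, an intermediate value on the convergence continuum would lie strictly between
  -- two values on S, against `himage`.
  have hvert_le : ∀ s t, φ (verticalParam s) ≤ φ (verticalParam t) := by
    intro s t
    by_contra! hlt
    obtain ⟨μ, hμ1, hμ2⟩ := exists_between hlt
    obtain ⟨r, -, hr⟩ := intermediate_value_uIcc
      (hφ.comp continuous_verticalParam).continuousOn
      (Icc_subset_uIcc ⟨hμ1.le, hμ2.le⟩ : μ ∈ uIcc (φ (verticalParam t)) (φ (verticalParam s)))
    obtain ⟨_, h1, ⟨s', rfl⟩⟩ := mem_closure_iff.1 (mem_closure_range_sineParam (verticalParam t))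
      {q | φ q < μ} (isOpen_lt hφ continuous_const) hμ1
    obtain ⟨_, h2, ⟨t', rfl⟩⟩ := mem_closure_iff.1 (mem_closure_range_sineParam (verticalParam s))
      {q | μ < φ q} (isOpen_lt continuous_const hφ) hμ2
    have hr' : arcCoord (F (sineInclusion (verticalParam r))) = μ := hr
    exact himage _ (sineInclusion_verticalParam_mem r) s' t' (hr'.symm ▸ h1) (hr'.symm ▸ h2)
  have hvert : ∀ s t, F (sineInclusion (verticalParam s)) = F (sineInclusion (verticalParam t)) :=
    fun s t => injOn_arcCoord (hall _) (hall _) ((hvert_le s t).antisymm (hvert_le t s))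
  -- Either `F` is constant on S, or it maps S into [a,b], where it is constant by `hvert`.
  obtain ⟨p', hp'⟩ : ∃ p', ∀ t, F (F (sineInclusion (sineParam t))) = p' := by
    by_cases hconst : ∀ s t, φ (sineParam s) ≤ φ (sineParam t)
    · refine ⟨F (F (sineInclusion (sineParam 0))), fun t => congrArg F ?_⟩
      exact injOn_arcCoord (hall _) (hall _) ((hconst _ _).antisymm (hconst _ _))
    · push Not at hconst
      obtain ⟨t₀, s₀, hst⟩ := hconst
      refine ⟨F (sineInclusion (verticalParam 0)), fun t => ?_⟩
      have hge : -1 ≤ φ (sineParam t) := by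
        by_contra! hlt
        have h0 := htail _ _ hst
        exact absurd (htail t t₀ (hlt.trans_le (h0.trans hst.le)))
          (not_le.2 hlt)
      have h0 : 0 ≤ (F (sineInclusion (sineParam t))).1.1 := by
        by_contra! hneg
        have h1 := extendedSineCurve.snd_of_neg hneg
        simp only [φ, arcCoord, h1] at hge
        linarith
      obtain ⟨r, hr⟩ := exists_sineInclusion_verticalParam_eq (hS t) h0
      rw [← hr]
      exact hvert r 0
  have hsq : ∀ q, F (F (sineInclusion q)) = p' := fun q =>
    closure_minimal (range_subset_iff.2 hp' : range sineParam ⊆ {q | F (F (sineInclusion q)) = p'})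
      (isClosed_eq (hF.comp hG) continuous_const) (mem_closure_range_sineParam q)
  have hopen : IsOpen {p : extendedSineCurve | -1 < p.1.2} :=
    isOpen_lt continuous_const (by fun_prop)
  refine sineInclusion_sineParam_notMem 0 (inl_mem_arcAndLimit.1 (hα.symm ▸
    mem_alphaLimitSet_of_iterate_eq (hmem _ (sineInclusion_verticalParam_mem 0))
      ((isOpenMap_inl _ hopen).mem_nhds (mem_image_of_mem _ ?_)) 2 ?_))
  · simp [sineInclusion, verticalParam]
  · rintro _ ⟨p, hp, rfl⟩
    have h0 : 0 ≤ p.1.1 := by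
      by_contra! hneg
      exact (extendedSineCurve.snd_of_neg hneg).not_gt hp
    simp only [Function.iterate_succ_apply, Function.iterate_zero_apply, hfF, hsq]
    rw [← sineInclusion_sineRetraction h0, hsq]

/-- Otherwise the curves, a connected set with `limitPt` in its closure, would map onto all of S
near the convergence continuum. By compactness the image would contain that continuum, but only
`limitPt` could map to it. -/
theorem exists_curve_mem_arcAC [T2Space Y] {H : Y → extendedSineCurve} (hH : Continuous H)
    (hlim : H C.limitPt ∈ arcAC) : ∃ i p, H (C.curve i p) ∈ arcAC := by
  by_contra! hcon
  have := C.compactSpace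
  let h : Y → closedSineCurve := fun y => sineRetraction (H y)
  have hh : Continuous h := continuous_sineRetraction.comp hH
  have hh1 : Continuous fun y => (h y).1.1 := by fun_prop
  have hzero : ∀ y, (h y).1.1 = 0 → y = C.limitPt := by
    intro y hy
    rcases C.eq_limitPt_or_eq_curve y with hy' | ⟨i, p, rfl⟩
    · exact hy'
    · exact (hcon i p (sineRetraction_fst_eq_zero_iff_mem_arcAC.1 hy)).elim
  let W : Set Y := ⋃ i, range (C.curve i)
  have hW : C.limitPt ∈ closure W := C.limitPt_mem_closure (n := 0) fun i _ =>
    ⟨C.curve i sineEnd, mem_range_self _, mem_iUnion.2 ⟨i, mem_range_self _⟩⟩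
  have hmemW : C.curve 0 sineEnd ∈ W := mem_iUnion.2 ⟨0, mem_range_self _⟩
  have hpos : 0 < (h (C.curve 0 sineEnd)).1.1 :=
    lt_of_le_of_ne (closedSineCurve.fst_nonneg _) fun h0 => C.curve_ne_limitPt _ _ (hzero _ h0.symm)
  have hsub : {q : closedSineCurve | 0 < q.1.1 ∧ q.1.1 < (h (C.curve 0 sineEnd)).1.1} ⊆
      range h := by
    rintro q ⟨hq0, hq1⟩
    obtain ⟨y, hy, hyW⟩ := mem_closure_iff.1 hW {y | (h y).1.1 < q.1.1}
      (isOpen_lt hh1 continuous_const)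
      (by rwa [mem_ofPred_eq, sineRetraction_fst_eq_zero_iff_mem_arcAC.2 hlim])
    obtain ⟨y', -, hy'⟩ := C.isConnected_iUnion.isPreconnected.intermediate_value hyW hmemW
      hh1.continuousOn (⟨hy.le, hq1.le⟩ : q.1.1 ∈ Icc _ _)
    replace hy' : (h y').1.1 = q.1.1 := hy'
    have h1 := (mem_closedSineCurve_iff.1 q.2).2.2.2.2 hq0
    have h2 := (mem_closedSineCurve_iff.1 (h y').2).2.2.2.2 (hy'.symm ▸ hq0)
    exact ⟨y', Subtype.ext (Prod.ext hy' (by rw [h1, h2, hy']))⟩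
  have hclosed : IsClosed (range h) := (isCompact_range hh).isClosed
  have hvert : ∀ t, verticalParam t = h C.limitPt := by
    intro t
    obtain ⟨y, hy⟩ := closure_minimal hsub hclosed (mem_closure_sine (verticalParam t) _ hpos rfl)
    rw [← hzero y (by rw [hy, verticalParam_fst]), hy]
  have hcontra := congrArg (fun q => q.1.2) ((hvert (Real.pi / 2)).trans (hvert 0).symm)
  simp [verticalParam] at hcontra

theorem map_curve_eq_map_curve (hα : arcAndLimit C = alphaLimitSet f z) {H : Y → extendedSineCurve}
    (hH : Continuous H) (hfH : ∀ y, f (Sum.inr y) = Sum.inl (H y))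
    (hz : ∀ k p, f^[k] (Sum.inl p) = z → p ∈ arcAC) {j : ℕ}
    (hj : ∀ q, H (C.curve j q) ∈ arcAC) (q q' : closedSineCurve) :
    H (C.curve j q) = H (C.curve j q') := by
  have hG : Continuous fun q => H (C.curve j q) := hH.comp (C.continuous_curve j)
  have hle : ∀ s t, arcCoord (H (C.curve j (sineParam s))) ≤
      arcCoord (H (C.curve j (sineParam t))) := by
    intro s t
    by_contra! hlt
    obtain ⟨n, hn⟩ := eventually_iterate_inl_ne (f := f) (z := z)
      (γ := fun t => Sum.inr (C.curve j (sineParam t)))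
      (continuous_inr.comp ((C.continuous_curve j).comp continuous_sineParam))
      (hG.comp continuous_sineParam) (fun t => hfH _) (fun t => hj _)
      (fun t ht => C.curve_ne_limitPt _ _ (inr_mem_arcAndLimit.1 (hα.symm ▸ ht))) t s
    obtain ⟨μ, hμ1, hμ2⟩ := exists_between hlt
    obtain ⟨r, -, hr⟩ := intermediate_value_uIcc
      (continuous_arcCoord.comp (hG.comp continuous_sineParam)).continuousOn
      (Icc_subset_uIcc ⟨hμ1.le, hμ2.le⟩ : μ ∈ uIcc (arcCoord (H (C.curve j (sineParam t))))
        (arcCoord (H (C.curve j (sineParam s)))))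
    replace hr : arcCoord (H (C.curve j (sineParam r))) = μ := hr
    have hV : IsOpen {p | arcCoord (H (C.curve j (sineParam t))) < arcCoord p ∧
        arcCoord p < arcCoord (H (C.curve j (sineParam s)))} :=
      (isOpen_lt continuous_const continuous_arcCoord).inter
        (isOpen_lt continuous_arcCoord continuous_const)
    -- The band `hV` also contains points of S, but `hz` puts the preimage `p` on the arc.
    obtain ⟨k, hk, p, ⟨hp1, hp2⟩, hpz⟩ := exists_iterate_inl_eq
      (hα ▸ inl_mem_arcAndLimit.2 (hj (sineParam r))) hV ⟨hr.symm ▸ hμ1, hr.symm ▸ hμ2⟩ n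
    exact hn k hk p (hz k p hpz) hp1 hp2 hpz
  have hsine : ∀ t, H (C.curve j (sineParam t)) = H (C.curve j (sineParam 0)) := fun t =>
    injOn_arcCoord (hj _) (hj _) ((hle _ _).antisymm (hle _ _))
  have hall : ∀ q, H (C.curve j q) = H (C.curve j (sineParam 0)) := fun q =>
    closure_minimal (range_subset_iff.2 hsine :
        range sineParam ⊆ {q | H (C.curve j q) = H (C.curve j (sineParam 0))})
      (isClosed_eq hG continuous_const) (mem_closure_range_sineParam q)
  rw [hall q, hall q']

theorem not_mapsTo_inl [T2Space Y] (hα : arcAndLimit C = alphaLimitSet f z)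
    {H : Y → extendedSineCurve} (hH : Continuous H) (hfH : ∀ y, f (Sum.inr y) = Sum.inl (H y))
    (hlim : H C.limitPt ∈ arcAC) (hz : ∀ k p, f^[k] (Sum.inl p) = z → p ∈ arcAC) : False := by
  obtain ⟨i, p, hp⟩ := exists_curve_mem_arcAC hH hlim
  have hclosed : IsClosed (H ⁻¹' arcAC) := isClosed_arcAC.preimage hH
  have hsat : IsCurveSaturated (H ⁻¹' arcAC) := fun γ hγ s t hs =>
    (forall_notMem_arcAC_or_forall_mem (hH.comp hγ)).resolve_left (fun h => h s hs) t
  have harc : ∀ j > i, ∀ q, H (C.curve j q) ∈ arcAC := fun j hj q =>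
    ChainOfSineCurves.curve_mem_of_lt hclosed hsat hj hp q
  have hconst : ∀ j > i, ∀ q, H (C.curve j q) = H (C.curve (i + 1) sineEnd) := by
    intro j hj
    induction j, hj using Nat.le_induction with
    | base => exact fun q => map_curve_eq_map_curve hα hH hfH hz (harc _ i.lt_succ_self) _ _
    | succ j hj ih =>
      intro q
      rw [map_curve_eq_map_curve hα hH hfH hz (harc (j + 1) (by omega)) q sineEnd,
        C.curve_succ_sineEnd, ← C.curve_jointEnd, ih]
  have hconst_lim : H C.limitPt = H (C.curve (i + 1) sineEnd) := by
    have hcl : IsClosed {y | H y = H (C.curve (i + 1) sineEnd)} := isClosed_eq hH continuous_const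
    exact hcl.closure_subset (C.limitPt_mem_closure (n := i) fun j hj =>
      ⟨C.curve j sineEnd, mem_range_self _, hconst j hj _⟩)
  let L : Set Y := ⋃ j ∈ Iic i, range (C.curve j)
  have hL : IsClosed L := ((finite_Iic i).isCompact_biUnion fun j _ =>
    isCompact_range (C.continuous_curve j)).isClosed
  -- As `f` is constant near `limitPt` with the same value at this endpoint, the endpoint inherits
  -- infinitely many hitting times of `z`.
  refine C.curve_ne_limitPt (i + 1) sineEnd (inr_mem_arcAndLimit.1 (hα.symm ▸
    mem_alphaLimitSet_of_iterate_eq (hα ▸ inr_mem_arcAndLimit.2 rfl)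
      ((isOpenMap_inr _ hL.isOpen_compl).mem_nhds (mem_image_of_mem _ ?_)) 1 ?_))
  · intro hmem
    obtain ⟨j, -, hj⟩ := mem_iUnion₂.1 hmem
    exact C.limitPt_notMem j hj
  · rintro _ ⟨y, hy, rfl⟩
    simp only [Function.iterate_one, hfH]
    rcases C.eq_limitPt_or_eq_curve y with rfl | ⟨j, q, rfl⟩
    · rw [hconst_lim]
    · rw [hconst j]
      by_contra! hji
      exact hy (mem_biUnion (mem_Iic.2 hji) (mem_range_self q))

end NotAlphaLimit

theorem not_isAlphaLimitSet_arcAndLimit {Y : Type*} [TopologicalSpace Y] [T2Space Y]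
    (C : ChainOfSineCurves Y) : ¬ IsAlphaLimitSet (arcAndLimit C) := by
  rintro ⟨f, hf, z, hα⟩
  have := C.connectedSpace
  have hmap : ∀ w ∈ arcAndLimit C, f w ∈ arcAndLimit C := by
    rw [hα]
    exact fun w hw => map_mem_alphaLimitSet hf hw
  rcases exists_eq_inl_or_exists_eq_inr (hf.comp continuous_inl) with ⟨F, hF, hfF⟩ | ⟨F, hF, hfF⟩
  swap
  · exact not_mapsTo_inr hα hf hF hfF
  replace hfF : ∀ p, f (Sum.inl p) = Sum.inl (F p) := hfF
  have hiter : ∀ k p, f^[k] (Sum.inl p) = Sum.inl (F^[k] p) := by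
    intro k
    induction k with
    | zero => exact fun p => rfl
    | succ k ih =>
      intro p
      rw [Function.iterate_succ_apply, hfF, ih, Function.iterate_succ_apply]
  have hFA : ∀ p ∈ arcAC, F p ∈ arcAC := by
    intro p hp
    have := hmap _ (inl_mem_arcAndLimit.2 hp)
    rwa [hfF, inl_mem_arcAndLimit] at this
  have htail : (tailParam (Real.pi / 2)).1.1 < 0 := by simp [tailParam]
  -- Near c all points lie on the arc, so a preimage of `z` close to c is in the forward invariant
  -- set, and so is `z`.
  obtain ⟨k, -, p, hp, hpz⟩ := exists_iterate_inl_eq (f := f) (z := z)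
    (hα ▸ inl_mem_arcAndLimit.2 (mem_arcAC_iff.2 htail.le))
    (isOpen_lt (by fun_prop) continuous_const : IsOpen {p : extendedSineCurve | p.1.1 < 0}) htail 0
  have hzA : z ∈ arcAndLimit C := by
    have hpα : Sum.inl p ∈ alphaLimitSet f z :=
      hα ▸ inl_mem_arcAndLimit.2 (mem_arcAC_iff.2 hp.le)
    have := iterate_mem_alphaLimitSet hf hpα k
    rwa [hpz, ← hα] at this
  rw [hiter] at hpz
  have hz₀ : F^[k] p ∈ arcAC := by rwa [← hpz, inl_mem_arcAndLimit] at hzA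
  rcases exists_eq_inl_or_exists_eq_inr (hf.comp continuous_inr) with ⟨H, hH, hfH⟩ | ⟨H, hH, hfH⟩
  swap
  · replace hfH : ∀ y, f (Sum.inr y) = Sum.inr (H y) := hfH
    have hinr : ∀ k y, ∃ y', f^[k] (Sum.inr y) = Sum.inr y' := by
      intro k
      induction k with
      | zero => exact fun y => ⟨y, rfl⟩
      | succ k ih =>
        intro y
        rw [Function.iterate_succ_apply, hfH]
        exact ih _
    have hmem : Sum.inr C.limitPt ∈ alphaLimitSet f z := hα ▸ inr_mem_arcAndLimit.2 rfl
    rw [mem_alphaLimitSet_iff] at hmem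
    obtain ⟨m, -, _, ⟨y, rfl⟩, hy⟩ := hmem 0 _ (isOpen_range_inr.mem_nhds (mem_range_self _))
    obtain ⟨y', hy'⟩ := hinr m y
    rw [← hpz, hy'] at hy
    exact Sum.inr_ne_inl hy
  replace hfH : ∀ y, f (Sum.inr y) = Sum.inl (H y) := hfH
  have hlim : H C.limitPt ∈ arcAC := by
    have := hmap _ (inr_mem_arcAndLimit.2 rfl)
    rwa [hfH, inl_mem_arcAndLimit] at this
  have hsine := (forall_notMem_arcAC_or_forall_mem (hF.comp (continuous_sineInclusion.comp
    continuous_sineParam))).resolve_right (not_forall_sineParam_mem_arcAC hα hF hfF hFA)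
  -- S is forward invariant and `z` is on the arc, so no point of S is ever mapped to `z`.
  have hcompl : ∀ k, ∀ q ∉ arcAC, F^[k] q ∉ arcAC := by
    intro k
    induction k with
    | zero => exact fun q hq => hq
    | succ k ih =>
      intro q hq
      obtain ⟨t, rfl⟩ := exists_sineInclusion_sineParam_eq hq
      exact ih _ (hsine t)
  refine not_mapsTo_inl hα hH hfH hlim fun m q hq => ?_
  by_contra hqA
  rw [hiter, ← hpz] at hq
  exact hcompl m q hqA (Sum.inl_injective hq ▸ hz₀)

theorem not_hasAFProperty_sum {Y : Type*} [TopologicalSpace Y] [T2Space Y]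
    (C : ChainOfSineCurves Y) : ¬ HasAFProperty (extendedSineCurve ⊕ Y) := fun h =>
  not_isAlphaLimitSet_arcAndLimit C (hasAFProperty_iff.1 h _ (isClosed_arcAndLimit C))

end Sum

theorem theorem3p2 :
    -- the existence statement
    (∃ (X Y : Type) (_ : TopologicalSpace X) (_ : TopologicalSpace Y),
      (ConnectedSpace X ∧ CompactSpace X ∧ TopologicalSpace.MetrizableSpace X ∧ HasAFProperty X) ∧
      (ConnectedSpace Y ∧ CompactSpace Y ∧ TopologicalSpace.MetrizableSpace Y ∧ HasAFProperty Y) ∧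
      ¬ HasAFProperty (X ⊕ Y)) ∧
    -- the extended sine curve
    (ConnectedSpace extendedSineCurve ∧ CompactSpace extendedSineCurve ∧
      TopologicalSpace.MetrizableSpace extendedSineCurve ∧ HasAFProperty extendedSineCurve) ∧
    -- chains of sine curves exist
    (∃ (Y : Type) (_ : TopologicalSpace Y), TopologicalSpace.MetrizableSpace Y ∧
      Nonempty (ChainOfSineCurves Y)) ∧
    -- the extended sine curve together with any chain of sine curves is such a pair
    (∀ (Y : Type*) [TopologicalSpace Y] [TopologicalSpace.MetrizableSpace Y]
      (C : ChainOfSineCurves Y),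
      (ConnectedSpace Y ∧ CompactSpace Y ∧ HasAFProperty Y) ∧
      IsClosed (arcAndLimit C) ∧
      ¬ IsAlphaLimitSet (arcAndLimit C) ∧
      ¬ HasAFProperty (extendedSineCurve ⊕ Y)) := by
  have hX : ConnectedSpace extendedSineCurve ∧ CompactSpace extendedSineCurve ∧
      TopologicalSpace.MetrizableSpace extendedSineCurve ∧ HasAFProperty extendedSineCurve :=
    ⟨inferInstance, inferInstance, inferInstance, hasAFProperty_extendedSineCurve⟩
  let C := planarChainOfSineCurves
  refine ⟨⟨extendedSineCurve, planarChain, inferInstance, inferInstance, hX,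
    ⟨C.connectedSpace, C.compactSpace, inferInstance, C.hasAFProperty⟩,
    not_hasAFProperty_sum C⟩, hX, ⟨planarChain, inferInstance, inferInstance, ⟨C⟩⟩, ?_⟩
  intro Y _ _ C
  exact ⟨⟨C.connectedSpace, C.compactSpace, C.hasAFProperty⟩, isClosed_arcAndLimit C,
    not_isAlphaLimitSet_arcAndLimit C, not_hasAFProperty_sum C⟩
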